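/- Let $R>0$, $e\neq 0$, $m\in\mathbb R$, and let $V=K(0,R)\subset\mathbb R^3$ be the open ball. For a point charge $e$ at $\vec a\in V$ put $D_{sing}(\vec r)=\frac{e(\vec r-\vec a)}{4\pi\|\vec r-\vec a\|^3}$. For a vector $\vec E\in\mathbb R^3$, the Neumann problem asks for a field $D=D_{sing}+D_{reg}$ with $\nabla\cdot D=e\,\boldsymbol\delta(\vec r-\vec a)$ in $V$ (in the sense of distributions), where $D_{reg}=-\nabla\phi_{reg}$ with $\phi_{reg}\in C^2(V)$, $D_{reg}$ is continuous on $\overline V$, and $D\cdot\vec n=\vec E\cdot\vec n+\frac{e}{4\pi R^2}$ on $\partial V$ ($\vec n$ the outer unit normal). The renormalized energy of a solution is $$\mathcal H_N=m-\frac12\int_{\mathbb R^3\setminus V}D_{sing}^2\,dv+\frac12\int_V D_{reg}^2\,dv+\int_V D_{sing}\cdot D_{reg}\,dv .$$ For $x\in\,]-1,1[$ and $q\in\mathbb R$ put $$\mathcal H'_N(x,q)=\frac1{1-x^2}-\ln(1-x^2)-2qx+\frac{q^2}{3}-2 .$$ Then: 1. For every $\vec a\in V$ and every $\vec E$ the Neumann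 problem has a solution. 2. Let $\vec u$ be a unit vector, $\vec E=E\vec u$, $\vec a=r_0\vec u$ with $E\in\mathbb R$, $|r_0|<R$, and put $x=r_0/R$, $q=4\pi R^2E/e$. For every solution the integrals in $\mathcal H_N$ converge absolutely, $$\mathcal H_N=m+\frac12\left(\frac{e^2}{4\pi}\Big(\frac{R}{R^2-r_0^2}-\frac1R\ln\Big(1-\frac{r_0^2}{R^2}\Big)-\frac2R\Big)+\frac43\pi R^3E^2-2eEr_0\right),$$ and $(\mathcal H_N-m)\frac{8\pi R}{e^2}=\mathcal H'_N(x,q)$. Moreover the equilibrium condition $D_{reg}(\vec a)=0$ holds if and only if $q=\frac{x(2-x^2)}{(1-x^2)^2}$. 3. For $x\in\,]-1,1[$ and $q\in\mathbb R$, $\partial_x\mathcal H'_N(x,q)=0$ if and only if $q=\frac{x(2-x^2)}{(1-x^2)^2}$; and for each $q$, $\mathcal H'_N(x,q)=-1+\frac{q^2}{3}-2qx+2x^2+O(x^4)$ as $x\to0$. 4. For every $q\in\mathbb R$ the function $\mathcal H'_N(\cdot,q)$ has a unique minimizer $x(q)$ on $]-1,1[$, which is also the unique $x\in\,]-1,1[$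 satisfying the equilibrium condition. For $\vec E=E\vec u$, $\vec u$ a unit vector, the position $\vec a=R\,x(4\pi R^2E/e)\,\vec u$ is the unique minimizer of the renormalized energy among all positions in $V$. As $q\to0$, $$x(q)=\frac q2+O(q^3),\qquad \mathcal H'_N\big(\tfrac q2,q\big)=-1-\frac{q^2}{6}+O(q^3),\qquad \mathcal H'_N(x(q),q)=-1-\frac{q^2}{6}+O(q^3).$$ 5. (Static instability.) There is $\delta>0$ such that $q\mapsto\mathcal H'_N(x(q),q)$ is strictly decreasing on $[0,\delta]$ and strictly increasing on $[-\delta,0]$. Likewise there is $\delta>0$ (depending on $R,e,m$) such that, if $\|\vec E_1\|<\|\vec E_2\|\le\delta$, then the total renormalized energy, with the particle at its energy-minimizing position, is strictly smaller for $\vec E_2$ than for $\vec E_1$. -/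

import Mathlib

open MeasureTheory Metric Set Topology Asymptotics
open scoped ContDiff

noncomputable section

/-- Euclidean three-space. -/
abbrev Space3 : Type := EuclideanSpace ℝ (Fin 3)

/-- The singular part of the field: the Coulomb field
`e (x - a) / (4 π ‖x - a‖³)` of a point charge `e` situated at `a`. -/
def coulombField (e : ℝ) (a x : Space3) : Space3 :=
  (e / (4 * Real.pi * ‖x - a‖ ^ 3)) • (x - a)

/-- The total field `D = D_sing + D_reg`. -/
def totalField (e : ℝ) (a : Space3) (Dreg : Space3 → Space3) (x : Space3) : Space3 :=
  coulombField e a x + Dreg x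

/-- `(φreg, Dreg)` is the regular part (potential and field) of a classical solution of the
electrostatic problem in the ball `K(0,R)` with a point charge `e` at `a` and with Neumann data
`D · n = E · n + e / (4 π R²)`, where `n = x / R` is the outer unit normal. -/
structure IsNeumannSolution (R e : ℝ) (a E : Space3)
    (φreg : Space3 → ℝ) (Dreg : Space3 → Space3) : Prop where
  /-- The regular potential is twice continuously differentiable inside the ball, -/
  contDiffOn : ContDiffOn ℝ 2 φreg (ball 0 R)
  /-- the regular field derives from it, `Dreg = - ∇ φreg`, -/
  hasGradientAt : ∀ x ∈ ball (0 : Space3) R, HasGradientAt φreg (-(Dreg x)) x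
  /-- and is continuous up to the boundary. -/
  continuousOn : ContinuousOn Dreg (closedBall 0 R)
  /-- Gauss law `∇ · D = e δ_a` in the sense of distributions on the open ball. -/
  gauss : ∀ ψ : Space3 → ℝ, ContDiff ℝ ∞ ψ → HasCompactSupport ψ →
    tsupport ψ ⊆ ball (0 : Space3) R →
    ∫ x in ball (0 : Space3) R, inner ℝ (totalField e a Dreg x) (gradient ψ x) = -(e * ψ a)
  /-- Neumann boundary condition for the total field. -/
  neumann : ∀ x ∈ sphere (0 : Space3) R,
    inner ℝ (totalField e a Dreg x) (R⁻¹ • x)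
      = inner ℝ E (R⁻¹ • x) + e / (4 * Real.pi * R ^ 2)

/-- All the integrals in the renormalized energy converge absolutely. -/
def EnergyConverges (R e : ℝ) (a : Space3) (Dreg : Space3 → Space3) : Prop :=
  IntegrableOn (fun x => ‖coulombField e a x‖ ^ 2) (ball (0 : Space3) R)ᶜ ∧
  IntegrableOn (fun x => ‖Dreg x‖ ^ 2) (ball (0 : Space3) R) ∧
  IntegrableOn (fun x => inner ℝ (coulombField e a x) (Dreg x)) (ball (0 : Space3) R)

/-- The renormalized energy contained in `V = K(0,R)`:
`m - ½ ∫_{ℝ³ - V} D_sing² + ½ ∫_V D_reg² + ∫_V D_sing · D_reg`. -/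
def renormalizedEnergy (m R e : ℝ) (a : Space3) (Dreg : Space3 → Space3) : ℝ :=
  m - 1 / 2 * (∫ x in (ball (0 : Space3) R)ᶜ, ‖coulombField e a x‖ ^ 2)
    + 1 / 2 * (∫ x in ball (0 : Space3) R, ‖Dreg x‖ ^ 2)
    + ∫ x in ball (0 : Space3) R, inner ℝ (coulombField e a x) (Dreg x)

/-- The position `a` in the ball minimizes the renormalized energy among all positions in the
ball, the Neumann data (that is, the vector `E`) being fixed. -/
def IsEnergyMinimizing (m R e : ℝ) (E a : Space3) : Prop :=
  a ∈ ball (0 : Space3) R ∧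
  ∀ (φ : Space3 → ℝ) (D : Space3 → Space3), IsNeumannSolution R e a E φ D →
  ∀ b ∈ ball (0 : Space3) R,
  ∀ (φ' : Space3 → ℝ) (D' : Space3 → Space3), IsNeumannSolution R e b E φ' D' →
    renormalizedEnergy m R e a D ≤ renormalizedEnergy m R e b D'

/-- The standardized Neumann energy `H'_N(x,q)`. -/
def stdEnergy (x q : ℝ) : ℝ :=
  1 / (1 - x ^ 2) - Real.log (1 - x ^ 2) - 2 * q * x + q ^ 2 / 3 - 2

end

/-! The regular field is explicit. With the image point `a* = R² a / |a|²`, the functions `imageDist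
= |a||x - a*|` and `imageVec = |a|²(x - a*)` are scaled so that they still make sense at `a = 0`.
The potential `regPotential` is that of an image charge plus a logarithm, singular only on the ray
leaving `a*` outwards. It is harmonic near the closed ball, and the logarithm makes the normal
component of `coulombField + regField` constant on the sphere. Adding the constant field `E` gives a
solution (`isNeumannSolution_regField`). It is the only one (`IsNeumannSolution.eqOn`): the
difference of two solutions is a divergence-free gradient with vanishing normal component, so
testing it against its own potential gives norm zero.

Write `C_b` for the Coulomb field of a charge at `b`, and `G` for `regField`. The energy rests on
the field `C_a + G - C_0`: it has divergence `e(δ_a - δ_0)` and no flux through the sphere, so it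
can be tested against functions that do not vanish on the boundary
(`integral_ball_inner_zeroFluxField_gradient`). Testing with `regPotential`, with a linear function
and with softened Coulomb potentials gives linear relations between the integrals. In the energy the
exterior integral of `|C_a|²` cancels and is never evaluated; only the exterior integral of `C_a ·
C_0` is needed, and it is `e²/(4πR)` for every `a`.

The resulting energy depends on `|a|` and on the component of `a` along `E`. For a fixed component
it increases with `|a|`, so minimizers lie on the axis, where the problem is the minimization of
`stdEnergy`. Its derivative in `x` is `2(g(x) - q)`, where `g = equilibriumCharge` is an increasing
bijection from `]-1,1[` to `ℝ`; hence the unique minimizer `g⁻¹(q)`. At the minimizer only the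
explicit dependence on `q` contributes to the variation of the energy, at the rate `2(q/3 - x)`.
This is negative for small `q > 0` because `x` is close to `q/2`, which is the static instability.
-/

/-! ### Polar coordinates and Gauss' law on the whole space. -/

open Filter in
-- The countable exceptional set is there for potentials with a kink on the sphere, which a ray
-- crosses at finitely many points.
theorem integral_Ioi_eq_of_hasDerivAt_off_countable {f f' : ℝ → ℝ} {l : ℝ} {s : Set ℝ}
    (hs : s.Countable) (hc : Continuous f) (hd : ∀ r ∈ Ioi 0 \ s, HasDerivAt f (f' r) r)
    (hi : IntegrableOn f' (Ioi 0)) (hl : Tendsto f atTop (𝓝 l)) :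
    ∫ r in Ioi 0, f' r = l - f 0 := by
  have h1 := intervalIntegral_tendsto_integral_Ioi 0 hi tendsto_id
  have h2 : Tendsto (fun b : ℝ => ∫ r in (0 : ℝ)..b, f' r) atTop (𝓝 (l - f 0)) := by
    refine (hl.sub_const (f 0)).congr' ?_
    filter_upwards [eventually_ge_atTop 0] with b hb
    refine (integral_eq_of_hasDerivAt_off_countable_of_le f f' hb hs hc.continuousOn
      (fun r hr => hd r ⟨hr.1.1, hr.2⟩) ?_).symm
    rw [intervalIntegrable_iff_integrableOn_Ioc_of_le hb]
    exact hi.mono_set Ioc_subset_Ioi_self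
  exact tendsto_nhds_unique h1 h2

theorem volume_real_ball_space3 (x : Space3) {r : ℝ} (hr : 0 ≤ r) :
    volume.real (ball x r) = 4 / 3 * Real.pi * r ^ 3 := by
  rw [measureReal_def, EuclideanSpace.volume_ball_fin_three, ← ENNReal.ofReal_pow hr,
    ← ENNReal.ofReal_mul (by positivity), ENNReal.toReal_ofReal (by positivity)]
  ring

theorem integral_space3_eq_integral_sphere_prod (f : Space3 → ℝ) :
    ∫ x, f x = ∫ p : sphere (0 : Space3) 1 × Ioi (0 : ℝ), f (p.2.1 • p.1.1)
      ∂((volume : Measure Space3).toSphere.prod (.volumeIoiPow 2)) := by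
  have h := (volume : Measure Space3).measurePreserving_homeomorphUnitSphereProd.integral_comp
        (Homeomorph.measurableEmbedding _)
        (fun p : sphere (0 : Space3) 1 × Ioi (0 : ℝ) => f (p.2.1 • p.1.1))
  rw [finrank_euclideanSpace_fin] at h
  rw [← h]
  calc ∫ x, f x = ∫ x : ({(0)}ᶜ : Set Space3), f x.1 ∂(volume.comap Subtype.val) := by
        rw [integral_subtype_comap (measurableSet_singleton _).compl f, restrict_compl_singleton]
    _ = _ := by
        refine integral_congr_ae (.of_forall fun x => ?_)
        have : ‖x.1‖ ≠ 0 := norm_ne_zero_iff.2 x.2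
        simp [smul_smul, this]

theorem integrable_sphere_prod {f : Space3 → ℝ} (hf : Integrable f) :
    Integrable (fun p : sphere (0 : Space3) 1 × Ioi (0 : ℝ) => f (p.2.1 • p.1.1))
      ((volume : Measure Space3).toSphere.prod (.volumeIoiPow 2)) := by
  have h := (volume : Measure Space3).measurePreserving_homeomorphUnitSphereProd.integrable_comp_emb
        (Homeomorph.measurableEmbedding _)
        (g := fun p : sphere (0 : Space3) 1 × Ioi (0 : ℝ) => f (p.2.1 • p.1.1))
  rw [finrank_euclideanSpace_fin] at h
  rw [← h]
  refine ((integrableOn_iff_comap_subtypeVal (measurableSet_singleton _).compl).1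
    (hf.integrableOn (s := {0}ᶜ))).congr (.of_forall fun x => ?_)
  have : ‖x.1‖ ≠ 0 := norm_ne_zero_iff.2 x.2
  simp [smul_smul, this]

theorem integral_volumeIoiPow_two (f : ℝ → ℝ) :
    ∫ r, f r.1 ∂(Measure.volumeIoiPow 2) = ∫ r in Ioi 0, r ^ 2 * f r := by
  simp only [Measure.volumeIoiPow, ENNReal.ofReal]
  rw [integral_withDensity_eq_integral_smul,
    integral_subtype_comap measurableSet_Ioi fun a ↦ Real.toNNReal (a ^ 2) • f a,
    setIntegral_congr_fun measurableSet_Ioi fun x hx ↦ ?_]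
  · rw [NNReal.smul_def, Real.coe_toNNReal _ (pow_nonneg hx.out.le _), smul_eq_mul]
  · exact (measurable_subtype_coe.pow_const _).real_toNNReal

theorem integrable_volumeIoiPow_two {f : ℝ → ℝ}
    (hf : Integrable (fun r : Ioi (0 : ℝ) => f r.1) (Measure.volumeIoiPow 2)) :
    IntegrableOn (fun r => r ^ 2 * f r) (Ioi 0) := by
  rw [Measure.volumeIoiPow, integrable_withDensity_iff_integrable_smul' (by fun_prop) (by simp)] at hf
  rw [integrableOn_iff_comap_subtypeVal measurableSet_Ioi]
  refine hf.congr (.of_forall fun r => ?_)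
  have : 0 < r.1 := r.2
  simp (disch := positivity) [ENNReal.toReal_ofReal]

open Filter in
/-- **Gauss' law** for the Coulomb field in the whole space, against a potential `ψ` vanishing at
infinity. -/
theorem integral_inner_coulombField (e : ℝ) (a : Space3) {ψ : Space3 → ℝ} {G : Space3 → Space3}
    (hc : Continuous ψ)
    (hd : ∀ w : Space3, ‖w‖ = 1 →
      {r : ℝ | ¬ HasGradientAt ψ (G (r • w + a)) (r • w + a)}.Countable)
    (hl : Tendsto ψ (cocompact Space3) (𝓝 0))
    (hi : Integrable fun x => inner ℝ (coulombField e a x) (G x)) :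
    ∫ x, inner ℝ (coulombField e a x) (G x) = -(e * ψ a) := by
  set f : Space3 → ℝ := fun y => inner ℝ (coulombField e a (y + a)) (G (y + a)) with hf
  have hif : Integrable f := hi.comp_add_right a
  -- The Jacobian `r²` cancels the inverse square of the field, leaving a multiple of the radial
  -- derivative of `ψ` along the ray from `a`.
  have key : ∀ w : Space3, ‖w‖ = 1 → ∀ r ∈ Ioi (0 : ℝ), r ^ 2 * f (r • w)
      = e / (4 * Real.pi) * inner ℝ (G (r • w + a)) w := by
    intro w hw r hr
    have hr' : 0 < r := hr
    simp only [hf, coulombField, add_sub_cancel_right, norm_smul, hw, Real.norm_eq_abs,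
      abs_of_pos hr', inner_smul_left, real_inner_comm w]
    simp
    field_simp
  have hder : ∀ w : Space3, ‖w‖ = 1 → ∀ r : ℝ,
      HasGradientAt ψ (G (r • w + a)) (r • w + a) →
      HasDerivAt (fun r : ℝ => ψ (r • w + a)) (inner ℝ (G (r • w + a)) w) r := by
    intro w hw r h
    have h1 : HasDerivAt (fun r : ℝ => r • w + a) w r := by
      simpa using ((hasDerivAt_id r).smul_const w).add_const a
    exact h.hasFDerivAt.comp_hasDerivAt r h1
  have hS : (volume : Measure Space3).toSphere.real univ = 4 * Real.pi := by
    rw [Measure.toSphere_real_apply_univ, finrank_euclideanSpace_fin,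
      volume_real_ball_space3 _ zero_le_one]
    push_cast; ring
  rw [← integral_add_right_eq_self _ a]
  change ∫ x, f x = _
  rw [integral_space3_eq_integral_sphere_prod, integral_prod _ (integrable_sphere_prod hif)]
  -- Each ray contributes `e/(4π) (0 - ψ a)`. Fubini gives integrability along almost every ray
  -- only, which suffices; the total area `4π` then finishes the computation.
  have hae : ∀ᵐ w ∂(volume : Measure Space3).toSphere,
      ∫ r : Ioi (0 : ℝ), f (r.1 • w.1) ∂(Measure.volumeIoiPow 2)
        = -(e / (4 * Real.pi) * ψ a) := by
    filter_upwards [(integrable_sphere_prod hif).prod_right_ae] with w hw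
    have hw1 : ‖w.1‖ = 1 := by simp
    have hint := integrable_volumeIoiPow_two (f := fun r => f (r • w.1)) hw
    rw [integral_volumeIoiPow_two (fun r => f (r • w.1))]
    have := integral_Ioi_eq_of_hasDerivAt_off_countable (l := 0)
      (f := fun r => e / (4 * Real.pi) * ψ (r • w.1 + a))
      (f' := fun r => r ^ 2 * f (r • w.1)) (hd w.1 hw1) (by fun_prop) ?_ hint ?_
    · rw [this]; simp
    · rintro r ⟨hr, hr'⟩
      rw [key _ hw1 r hr]
      exact (hder _ hw1 r (by simpa using hr')).const_mul _
    · have : Tendsto (fun r : ℝ => r • w.1 + a) atTop (cocompact Space3) := by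
        rw [← Metric.cobounded_eq_cocompact, ← tendsto_norm_atTop_iff_cobounded]
        refine tendsto_atTop_mono' _ ?_ (tendsto_atTop_add_const_right _ (-‖a‖) tendsto_id)
        filter_upwards [eventually_ge_atTop 0] with r hr
        have := norm_sub_norm_le (r • w.1) (-a)
        rw [norm_smul, hw1, norm_neg, Real.norm_of_nonneg hr, mul_one, sub_neg_eq_add] at this
        exact this
      simpa using (hl.comp this).const_mul (e / (4 * Real.pi))
  rw [integral_congr_ae hae, integral_const, hS]
  have := Real.pi_pos
  simp only [smul_eq_mul]
  field_simp

/-! ### Calculus of gradients and divergences, and integration by parts. -/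

theorem HasGradientAt.mul {f g : Space3 → ℝ} {f' g' x : Space3} (hf : HasGradientAt f f' x)
    (hg : HasGradientAt g g' x) :
    HasGradientAt (fun y => f y * g y) (f x • g' + g x • f') x := by
  have := HasFDerivAt.mul hf hg
  rw [hasGradientAt_iff_hasFDerivAt]
  rw [map_add, map_smul, map_smul]
  exact this

theorem HasGradientAt.add {f g : Space3 → ℝ} {f' g' x : Space3} (hf : HasGradientAt f f' x)
    (hg : HasGradientAt g g' x) : HasGradientAt (fun y => f y + g y) (f' + g') x := by
  have := HasFDerivAt.add hf hg
  rw [hasGradientAt_iff_hasFDerivAt]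
  rw [map_add]
  exact this

theorem HasGradientAt.sub {f g : Space3 → ℝ} {f' g' x : Space3} (hf : HasGradientAt f f' x)
    (hg : HasGradientAt g g' x) : HasGradientAt (fun y => f y - g y) (f' - g') x := by
  have := HasFDerivAt.sub hf hg
  rw [hasGradientAt_iff_hasFDerivAt]
  rw [map_sub]
  exact this

theorem HasGradientAt.const_mul {f : Space3 → ℝ} {f' x : Space3} (c : ℝ)
    (hf : HasGradientAt f f' x) : HasGradientAt (fun y => c * f y) (c • f') x := by
  have := HasFDerivAt.const_mul hf c
  rw [hasGradientAt_iff_hasFDerivAt]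
  rw [map_smul]
  exact this

theorem HasDerivAt.comp_hasGradientAt {f : Space3 → ℝ} {h : ℝ → ℝ} {h' : ℝ} {f' : Space3}
    (x : Space3) (hh : HasDerivAt h h' (f x)) (hf : HasGradientAt f f' x) :
    HasGradientAt (fun y => h (f y)) (h' • f') x := by
  have := hh.comp_hasFDerivAt x hf.hasFDerivAt
  rw [hasGradientAt_iff_hasFDerivAt]
  rw [map_smul]
  exact this

theorem hasGradientAt_inner_right (a x : Space3) : HasGradientAt (fun y => inner ℝ y a) a x := by
  rw [hasGradientAt_iff_hasFDerivAt]
  have := (InnerProductSpace.toDual ℝ Space3 a).hasFDerivAt (x := x)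
  refine this.congr_of_eventuallyEq (.of_forall fun y => ?_)
  simp [real_inner_comm]

theorem hasGradientAt_norm_sq (x : Space3) : HasGradientAt (fun y => ‖y‖ ^ 2) ((2 : ℝ) • x) x := by
  rw [hasGradientAt_iff_hasFDerivAt]
  have := (hasStrictFDerivAt_norm_sq x).hasFDerivAt
  rw [map_smul]
  refine this.congr_fderiv ?_
  ext y
  simp

theorem continuousOn_gradient {ψ : Space3 → ℝ} {U : Set Space3} (hU : IsOpen U)
    (hψ : ContDiffOn ℝ 1 ψ U) : ContinuousOn (gradient ψ) U :=
  (InnerProductSpace.toDual ℝ Space3).symm.continuous.comp_continuousOn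
    (hψ.continuousOn_fderiv_of_isOpen hU le_rfl)

/-- The divergence of a vector field on Euclidean three-space. -/
noncomputable def divergence (F : Space3 → Space3) (x : Space3) : ℝ :=
  ∑ i, fderiv ℝ F x (EuclideanSpace.single i 1) i

theorem divergence_const (c x : Space3) : divergence (fun _ => c) x = 0 := by
  simp [divergence]

theorem divergence_id (x : Space3) : divergence (fun y => y) x = 3 := by
  simp [divergence]

theorem divergence_add {F G : Space3 → Space3} {x : Space3} (hF : DifferentiableAt ℝ F x)
    (hG : DifferentiableAt ℝ G x) :
    divergence (fun y => F y + G y) x = divergence F x + divergence G x := by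
  simp [divergence, fderiv_fun_add hF hG, Finset.sum_add_distrib]

theorem divergence_const_smul {F : Space3 → Space3} {x : Space3} (c : ℝ)
    (hF : DifferentiableAt ℝ F x) :
    divergence (fun y => c • F y) x = c * divergence F x := by
  simp [divergence, fderiv_fun_const_smul hF, Finset.mul_sum]

theorem divergence_smul {f : Space3 → ℝ} {F : Space3 → Space3} {f' x : Space3}
    (hf : HasGradientAt f f' x) (hF : DifferentiableAt ℝ F x) :
    divergence (fun y => f y • F y) x = f x * divergence F x + inner ℝ f' (F x) := by
  have h := hf.hasFDerivAt.fun_smul hF.hasFDerivAt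
  simp only [divergence, h.fderiv]
  simp [Finset.sum_add_distrib, Finset.mul_sum, PiLp.inner_apply, mul_comm]

theorem integrable_mul_of_tsupport_subset {U : Set Space3} (hU : IsOpen U) {f g : Space3 → ℝ}
    (hf : Continuous f) (hc : HasCompactSupport f) (hs : tsupport f ⊆ U) (hg : ContinuousOn g U) :
    Integrable fun x => g x * f x := by
  have hts : tsupport (fun x => g x * f x) ⊆ tsupport f := tsupport_mul_subset_right
  exact ((hg.mul hf.continuousOn).continuous_of_tsupport_subset hU
    (hts.trans hs)).integrable_of_hasCompactSupport hc.mul_left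

/-- Integration by parts, one coordinate at a time. Regularity of `F` is needed only near the
support of `χ`, so fields that are smooth just inside the open ball are allowed. -/
theorem integral_inner_gradient_eq_neg_divergence {U : Set Space3} (hU : IsOpen U)
    {F : Space3 → Space3} {χ : Space3 → ℝ} (hF : ContDiffOn ℝ 1 F U) (hχ : ContDiff ℝ 1 χ)
    (hc : HasCompactSupport χ) (hs : tsupport χ ⊆ U) :
    ∫ x, inner ℝ (F x) (gradient χ x) = -∫ x, divergence F x * χ x := by
  have hd : ∀ x ∈ U, DifferentiableAt ℝ F x := fun x hx =>
    (hF.differentiableOn one_ne_zero).differentiableAt (hU.mem_nhds hx)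
  have hFc : ∀ i, ContinuousOn (fun x => F x i) U := fun i =>
    (EuclideanSpace.proj (𝕜 := ℝ) i).continuous.comp_continuousOn hF.continuousOn
  have hfd : ∀ i, ∀ x ∈ U, HasFDerivAt (fun x => F x i)
      ((EuclideanSpace.proj (𝕜 := ℝ) i).comp (fderiv ℝ F x)) x := fun i x hx =>
    (EuclideanSpace.proj (𝕜 := ℝ) i).hasFDerivAt.comp x (hd x hx).hasFDerivAt
  have hF'c : ∀ i, ContinuousOn (fun x => fderiv ℝ F x (EuclideanSpace.single i 1) i) U :=
    fun i => (EuclideanSpace.proj (𝕜 := ℝ) i).continuous.comp_continuousOn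
      ((hF.continuousOn_fderiv_of_isOpen hU le_rfl).clm_apply continuousOn_const)
  have hχ'c : ∀ v, Continuous fun x => fderiv ℝ χ x v := fun v =>
    (hχ.continuous_fderiv one_ne_zero).clm_apply continuous_const
  have hχ's : ∀ v, tsupport (fun x => fderiv ℝ χ x v) ⊆ tsupport χ := fun v =>
    tsupport_fderiv_apply_subset ℝ v
  have h1 : ∀ i, Integrable fun x => F x i * fderiv ℝ χ x (EuclideanSpace.single i 1) := fun i =>
    integrable_mul_of_tsupport_subset hU (hχ'c _) (hc.fderiv_apply ℝ _) ((hχ's _).trans hs) (hFc i)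
  have h2 : ∀ i, Integrable fun x => fderiv ℝ F x (EuclideanSpace.single i 1) i * χ x := fun i =>
    integrable_mul_of_tsupport_subset hU hχ.continuous hc hs (hF'c i)
  have h3 : ∀ i, ∫ x, F x i * fderiv ℝ χ x (EuclideanSpace.single i 1)
      = -∫ x, fderiv ℝ F x (EuclideanSpace.single i 1) i * χ x := fun i =>
    integral_bilinear_hasFDerivAt_right_eq_neg_left_of_integrable
      (B := ContinuousLinearMap.mul ℝ ℝ) (h2 i) (h1 i)
      (integrable_mul_of_tsupport_subset hU hχ.continuous hc hs (hFc i))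
      (fun x hx => hfd i x (hs hx)) (fun x _ => (hχ.differentiable one_ne_zero x).hasFDerivAt)
  have h4 : ∀ x, inner ℝ (F x) (gradient χ x)
      = ∑ i, F x i * fderiv ℝ χ x (EuclideanSpace.single i 1) := fun x => by
    rw [PiLp.inner_apply]
    refine Finset.sum_congr rfl fun i _ => ?_
    have : (gradient χ x) i = fderiv ℝ χ x (EuclideanSpace.single i 1) := by
      rw [← inner_gradient_left, EuclideanSpace.inner_single_right]
      simp
    simp [this, mul_comm]
  simp_rw [h4, divergence, Finset.sum_mul]
  rw [integral_finsetSum _ fun i _ => h1 i, integral_finsetSum _ fun i _ => h2 i,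
    ← Finset.sum_neg_distrib]
  exact Finset.sum_congr rfl fun i _ => h3 i

theorem contDiff_mul_of_tsupport_subset {U : Set Space3} (hU : IsOpen U) {η ψ : Space3 → ℝ}
    {n : ℕ∞} (hη : ContDiff ℝ n η) (hs : tsupport η ⊆ U) (hψ : ContDiffOn ℝ n ψ U) :
    ContDiff ℝ n fun x => η x * ψ x := by
  rw [contDiff_iff_contDiffAt]
  intro x
  by_cases hx : x ∈ U
  · exact hη.contDiffAt.mul (hψ.contDiffAt (hU.mem_nhds hx))
  · have h0 : η =ᶠ[𝓝 x] 0 := notMem_tsupport_iff_eventuallyEq.1 fun h => hx (hs h)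
    refine (contDiffAt_const (c := (0 : ℝ))).congr_of_eventuallyEq ?_
    filter_upwards [h0] with y hy
    simp [hy]

/-! ### Radial cutoffs, and test functions that do not vanish on the sphere. -/

/-- A smooth radial cutoff, equal to `1` where `R² - ‖x‖² ≥ 2 / n` and to `0` where
`R² - ‖x‖² ≤ 1 / n`. -/
noncomputable def radialCutoff (R : ℝ) (n : ℕ) (x : Space3) : ℝ :=
  Real.smoothTransition (n * (R ^ 2 - ‖x‖ ^ 2) - 1)

/-- The density `w` for which `∇ (radialCutoff R n) x = - w x • x`. -/
noncomputable def radialCutoffSlope (R : ℝ) (n : ℕ) (x : Space3) : ℝ :=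
  2 * n * deriv Real.smoothTransition (n * (R ^ 2 - ‖x‖ ^ 2) - 1)

section

variable {R : ℝ} {n : ℕ}

theorem contDiff_radialCutoff {m : ℕ∞} : ContDiff ℝ m (radialCutoff R n) := by
  refine Real.smoothTransition.contDiff.comp ?_
  have := contDiff_norm_sq (𝕜 := ℝ) (E := Space3) (n := m)
  fun_prop

theorem radialCutoff_nonneg (x : Space3) : 0 ≤ radialCutoff R n x :=
  Real.smoothTransition.nonneg _

theorem radialCutoff_le_one (x : Space3) : radialCutoff R n x ≤ 1 :=
  Real.smoothTransition.le_one _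

theorem continuous_radialCutoffSlope : Continuous (radialCutoffSlope R n) := by
  have h : Continuous (deriv Real.smoothTransition) :=
    (Real.smoothTransition.contDiff (n := 1)).continuous_deriv le_rfl
  unfold radialCutoffSlope
  fun_prop

theorem radialCutoffSlope_nonneg (x : Space3) : 0 ≤ radialCutoffSlope R n x := by
  have : 0 ≤ deriv Real.smoothTransition (n * (R ^ 2 - ‖x‖ ^ 2) - 1) :=
    Real.smoothTransition.monotone.deriv_nonneg
  unfold radialCutoffSlope
  positivity

theorem hasGradientAt_radialCutoff (x : Space3) :
    HasGradientAt (radialCutoff R n) (-(radialCutoffSlope R n x • x)) x := by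
  have h1 : HasDerivAt (fun s : ℝ => n * (R ^ 2 - s) - 1) (-(n : ℝ)) (‖x‖ ^ 2) := by
    simpa using (((hasDerivAt_id (‖x‖ ^ 2)).const_sub (R ^ 2)).const_mul (n : ℝ)).sub_const 1
  have h2 := ((Real.smoothTransition.contDiff (n := 1)).differentiable one_ne_zero
    (n * (R ^ 2 - ‖x‖ ^ 2) - 1)).hasDerivAt
  have h3 := (h2.comp (‖x‖ ^ 2) h1).comp_hasGradientAt x (hasGradientAt_norm_sq x)
  have h4 : HasGradientAt (radialCutoff R n) _ x := h3
  convert h4 using 1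
  rw [smul_smul, ← neg_smul]
  unfold radialCutoffSlope
  congr 1
  ring

theorem radialCutoffSlope_eq_zero {x : Space3} (hx : R ^ 2 - ‖x‖ ^ 2 > 2 / n) :
    radialCutoffSlope R n x = 0 := by
  rcases Nat.eq_zero_or_pos n with rfl | hn
  · simp [radialCutoffSlope]
  have hn' : (0 : ℝ) < n := by exact_mod_cast hn
  have h1 : 1 < n * (R ^ 2 - ‖x‖ ^ 2) - 1 := by
    have := (div_lt_iff₀' hn').1 hx
    linarith
  have h2 : Real.smoothTransition =ᶠ[𝓝 (n * (R ^ 2 - ‖x‖ ^ 2) - 1)] fun _ => 1 := by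
    filter_upwards [lt_mem_nhds h1] with s hs using Real.smoothTransition.one_of_one_le hs.le
  simp [radialCutoffSlope, h2.deriv_eq]

theorem tsupport_radialCutoff_subset :
    tsupport (radialCutoff R n) ⊆ {x | 1 ≤ n * (R ^ 2 - ‖x‖ ^ 2)} := by
  refine closure_minimal (fun x hx => ?_) (isClosed_le (by fun_prop) (by fun_prop))
  by_contra h
  exact hx (Real.smoothTransition.zero_of_nonpos (by simp at h; linarith))

theorem tsupport_radialCutoff_subset_ball (hR : 0 < R) :
    tsupport (radialCutoff R n) ⊆ ball (0 : Space3) R := by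
  intro x hx
  have h : 1 ≤ n * (R ^ 2 - ‖x‖ ^ 2) := tsupport_radialCutoff_subset hx
  have : 0 < R ^ 2 - ‖x‖ ^ 2 := pos_of_mul_pos_right (by linarith) (Nat.cast_nonneg n)
  simpa using lt_of_pow_lt_pow_left₀ 2 hR.le (by linarith)

theorem hasCompactSupport_radialCutoff (hR : 0 < R) :
    HasCompactSupport (radialCutoff R n : Space3 → ℝ) :=
  (isCompact_closedBall (0 : Space3) R).of_isClosed_subset (isClosed_tsupport _)
    ((tsupport_radialCutoff_subset_ball hR).trans ball_subset_closedBall)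

theorem support_radialCutoffSlope_subset (hR : 0 < R) :
    tsupport (radialCutoffSlope R n) ⊆ closedBall (0 : Space3) R := by
  refine closure_minimal (fun x hx => ?_) isClosed_closedBall
  by_contra h
  have hx' : x ∉ tsupport (radialCutoff R n) := fun h' =>
    h (ball_subset_closedBall (tsupport_radialCutoff_subset_ball hR h'))
  have h0 := (notMem_tsupport_iff_eventuallyEq.1 hx').gradient_eq
  rw [(hasGradientAt_radialCutoff x).gradient] at h0
  -- The gradient of the cutoff determines the slope only away from the origin.
  have hne : x ≠ 0 := by rintro rfl; simp [hR.le] at h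
  have : gradient (0 : Space3 → ℝ) x = 0 := gradient_const x 0
  rw [this, neg_eq_zero, smul_eq_zero] at h0
  exact hx (h0.resolve_right hne)

theorem integrable_radialCutoffSlope (hR : 0 < R) : Integrable (radialCutoffSlope R n) :=
  continuous_radialCutoffSlope.integrable_of_hasCompactSupport
    ((isCompact_closedBall (0 : Space3) R).of_isClosed_subset (isClosed_tsupport _)
      (support_radialCutoffSlope_subset hR))

theorem eventually_radialCutoff_eq_one {x : Space3} (hx : x ∈ ball (0 : Space3) R) :
    ∀ᶠ n : ℕ in Filter.atTop, radialCutoff R n x = 1 := by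
  have h : 0 < R ^ 2 - ‖x‖ ^ 2 := by
    have : ‖x‖ < R := by simpa using hx
    nlinarith [norm_nonneg x]
  have := (tendsto_natCast_atTop_atTop (R := ℝ)).atTop_mul_const h
  filter_upwards [this.eventually_ge_atTop 2] with n hn
  exact Real.smoothTransition.one_of_one_le (by linarith)

/-- The slope grows like `n` on a shell of thickness of order `1/n`, so its mass stays bounded.
Pairing `∇χ` with the field `x`, of divergence `3`, gives `∫ w |x|² = 3 ∫ χ`, at most three times
the volume of the ball. The condition on `n` gives `|x|² ≥ R²/2` wherever `w ≠ 0`, whence the factor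
`6/R²`. -/
theorem integral_radialCutoffSlope_le (hR : 0 < R) (hn : 4 / R ^ 2 < n) :
    ∫ x, radialCutoffSlope R n x ≤ 6 / R ^ 2 * volume.real (ball (0 : Space3) R) := by
  have h1 := integral_inner_gradient_eq_neg_divergence isOpen_univ (F := fun x => x)
    (χ := radialCutoff R n) contDiff_id.contDiffOn contDiff_radialCutoff
    (hasCompactSupport_radialCutoff hR) (subset_univ _)
  have h2 : ∀ x : Space3, inner ℝ x (gradient (radialCutoff R n) x)
      = -(radialCutoffSlope R n x * ‖x‖ ^ 2) := fun x => by
    rw [(hasGradientAt_radialCutoff x).gradient, inner_neg_right, real_inner_smul_right,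
      real_inner_self_eq_norm_sq]
  simp only [h2, divergence_id, integral_neg, integral_const_mul, neg_inj] at h1
  have h3 : ∀ x : Space3, radialCutoffSlope R n x * (R ^ 2 / 2)
      ≤ radialCutoffSlope R n x * ‖x‖ ^ 2 := fun x => by
    by_cases hx : R ^ 2 - ‖x‖ ^ 2 > 2 / n
    · simp [radialCutoffSlope_eq_zero hx]
    · refine mul_le_mul_of_nonneg_left ?_ (radialCutoffSlope_nonneg x)
      have hn0 : (0 : ℝ) < n := lt_trans (by positivity) hn
      have : 2 / n < R ^ 2 / 2 := by
        rw [div_lt_iff₀ (by positivity)] at hn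
        rw [div_lt_div_iff₀ hn0 two_pos]
        linarith
      linarith
  have h4 : ∫ x : Space3, radialCutoff R n x ≤ volume.real (ball (0 : Space3) R) := by
    have h5 : ∀ x : Space3, radialCutoff R n x ≤ (ball (0 : Space3) R).indicator 1 x := fun x => by
      by_cases hx : x ∈ ball (0 : Space3) R
      · simpa [hx] using radialCutoff_le_one x
      · have : x ∉ tsupport (radialCutoff R n) :=
          fun h => hx (tsupport_radialCutoff_subset_ball hR h)
        simp [hx, image_eq_zero_of_notMem_tsupport this]
    refine (integral_mono (contDiff_radialCutoff (m := 0).continuous.integrable_of_hasCompactSupport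
      (hasCompactSupport_radialCutoff hR)) ?_ h5).trans_eq ?_
    · exact (integrable_indicator_iff measurableSet_ball).2
        (integrableOn_const measure_ball_lt_top.ne)
    · simp [integral_indicator_one measurableSet_ball]
  have h6 : (∫ x, radialCutoffSlope R n x) * (R ^ 2 / 2)
      ≤ ∫ x : Space3, radialCutoffSlope R n x * ‖x‖ ^ 2 := by
    rw [← integral_mul_const]
    refine integral_mono ((integrable_radialCutoffSlope hR).mul_const _) ?_ h3
    have hc : HasCompactSupport (radialCutoffSlope R n) :=
      (isCompact_closedBall (0 : Space3) R).of_isClosed_subset (isClosed_tsupport _)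
      (support_radialCutoffSlope_subset hR)
    exact (continuous_radialCutoffSlope.mul (by fun_prop)).integrable_of_hasCompactSupport
      hc.mul_right
  rw [h1] at h6
  rw [div_mul_eq_mul_div, le_div_iff₀ (by positivity)]
  linarith

theorem IntegrableOn.inner_of_bounded {s : Set Space3} {F G : Space3 → Space3} {M : ℝ}
    (hs : MeasurableSet s) (hF : IntegrableOn F s) (hG : ContinuousOn G s)
    (hM : ∀ x ∈ s, ‖G x‖ ≤ M) : IntegrableOn (fun x => inner ℝ (F x) (G x)) s := by
  refine Integrable.mono' (hF.norm.mul_const M)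
    (hF.aestronglyMeasurable.inner (hG.aestronglyMeasurable hs)) ?_
  filter_upwards [ae_restrict_mem hs] with x hx
  exact (norm_inner_le_norm _ _).trans (mul_le_mul_of_nonneg_left (hM x hx) (norm_nonneg _))

open Filter in
/-- If the flux of `F` across the sphere vanishes and `∇ · F = c (δ_a - δ_b)` inside the ball, then
the weak form of this equation holds for test functions that do not vanish on the boundary. -/
theorem integral_ball_inner_gradient_of_zero_flux (hR : 0 < R) {F : Space3 → Space3} {c : ℝ}
    {a b : Space3} (ha : a ∈ ball (0 : Space3) R) (hb : b ∈ ball (0 : Space3) R)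
    (hF : ∀ χ : Space3 → ℝ, ContDiff ℝ 1 χ → HasCompactSupport χ → tsupport χ ⊆ ball 0 R →
      ∫ x in ball (0 : Space3) R, inner ℝ (F x) (gradient χ x) = c * (χ a - χ b))
    (hFi : IntegrableOn F (ball 0 R))
    (hflux : ∀ ε > 0, ∃ r < R, ∀ x, r < ‖x‖ → ‖x‖ < R → |inner ℝ (F x) x| ≤ ε)
    {ψ : Space3 → ℝ} {M : ℝ} (hψ : ContDiffOn ℝ 1 ψ (ball 0 R))
    (hψM : ∀ x ∈ ball (0 : Space3) R, |ψ x| ≤ M)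
    (hψM' : ∀ x ∈ ball (0 : Space3) R, ‖gradient ψ x‖ ≤ M) :
    ∫ x in ball (0 : Space3) R, inner ℝ (F x) (gradient ψ x) = c * (ψ a - ψ b) := by
  have hM : 0 ≤ M := (abs_nonneg _).trans (hψM a ha)
  have hgc := continuousOn_gradient isOpen_ball hψ
  -- The hypothesis is applied to the product of the cutoff and `ψ`. One part of its gradient
  -- converges to `∇ψ`; the other is radial and sees only the flux of `F` near the sphere.
  have hgrad : ∀ n : ℕ, ∀ x ∈ ball (0 : Space3) R,
      gradient (fun y => radialCutoff R n y * ψ y) x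
        = radialCutoff R n x • gradient ψ x + (-(ψ x * radialCutoffSlope R n x)) • x := by
    intro n x hx
    have h := ((hψ.differentiableOn one_ne_zero).differentiableAt
      (isOpen_ball.mem_nhds hx)).hasGradientAt
    rw [((hasGradientAt_radialCutoff (R := R) (n := n) x).mul h).gradient]
    simp [smul_smul]
  have hi1 : ∀ n : ℕ, IntegrableOn
      (fun x => inner ℝ (F x) (radialCutoff R n x • gradient ψ x)) (ball 0 R) := fun n =>
    IntegrableOn.inner_of_bounded (M := M) measurableSet_ball hFi
      ((contDiff_radialCutoff (m := 0)).continuous.continuousOn.smul hgc) fun x hx => by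
        rw [norm_smul, Real.norm_of_nonneg (radialCutoff_nonneg x)]
        calc _ ≤ 1 * ‖gradient ψ x‖ := by gcongr; exact radialCutoff_le_one x
          _ ≤ M := by rw [one_mul]; exact hψM' x hx
  have hi2 : ∀ n : ℕ, IntegrableOn
      (fun x => inner ℝ (F x) ((-(ψ x * radialCutoffSlope R n x)) • x)) (ball 0 R) := fun n => by
    obtain ⟨K, hK⟩ := (isCompact_closedBall (0 : Space3) R).exists_bound_of_continuousOn
      (continuous_radialCutoffSlope (R := R) (n := n)).continuousOn
    refine IntegrableOn.inner_of_bounded (M := M * K * R) measurableSet_ball hFi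
      ((hψ.continuousOn.mul continuous_radialCutoffSlope.continuousOn).neg.smul
        continuousOn_id) fun x hx => ?_
    rw [norm_smul, norm_neg, norm_mul]
    have h1 := hK x (ball_subset_closedBall hx)
    have h2 : ‖x‖ ≤ R := by simpa using (ball_subset_closedBall hx)
    have h3 : ‖ψ x‖ ≤ M := hψM x hx
    gcongr
    exact mul_nonneg hM ((norm_nonneg _).trans h1)
  have hsplit : ∀ n : ℕ, ∫ x in ball (0 : Space3) R, inner ℝ (F x) (radialCutoff R n x • gradient ψ x)
      = c * (radialCutoff R n a * ψ a - radialCutoff R n b * ψ b)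
        - ∫ x in ball (0 : Space3) R, inner ℝ (F x) ((-(ψ x * radialCutoffSlope R n x)) • x) := by
    intro n
    rw [← hF (fun x => radialCutoff R n x * ψ x)
      (contDiff_mul_of_tsupport_subset (n := 1) isOpen_ball contDiff_radialCutoff
        (tsupport_radialCutoff_subset_ball hR) hψ)
      (hasCompactSupport_radialCutoff hR).mul_right
      (tsupport_mul_subset_left.trans (tsupport_radialCutoff_subset_ball hR)),
      eq_sub_iff_add_eq, ← integral_add (hi1 n) (hi2 n)]
    refine setIntegral_congr_fun measurableSet_ball fun x hx => ?_
    simp only [hgrad n x hx, inner_add_right]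
  have hlim1 : Tendsto (fun n : ℕ =>
      ∫ x in ball (0 : Space3) R, inner ℝ (F x) (radialCutoff R n x • gradient ψ x)) atTop
      (𝓝 (∫ x in ball (0 : Space3) R, inner ℝ (F x) (gradient ψ x))) := by
    refine tendsto_integral_of_dominated_convergence (fun x => ‖F x‖ * M)
      (fun n => (hi1 n).aestronglyMeasurable) (hFi.norm.mul_const M) (fun n => ?_) ?_
    · filter_upwards [ae_restrict_mem measurableSet_ball] with x hx
      refine (norm_inner_le_norm _ _).trans (mul_le_mul_of_nonneg_left ?_ (norm_nonneg _))
      rw [norm_smul, Real.norm_of_nonneg (radialCutoff_nonneg x)]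
      calc _ ≤ 1 * ‖gradient ψ x‖ := by gcongr; exact radialCutoff_le_one x
        _ ≤ M := by rw [one_mul]; exact hψM' x hx
    · filter_upwards [ae_restrict_mem measurableSet_ball] with x hx
      refine tendsto_const_nhds.congr' ?_
      filter_upwards [eventually_radialCutoff_eq_one hx] with n hn
      simp [hn]
  have hlim2 : Tendsto (fun n : ℕ => ∫ x in ball (0 : Space3) R,
      inner ℝ (F x) ((-(ψ x * radialCutoffSlope R n x)) • x)) atTop (𝓝 0) := by
    set C := 6 / R ^ 2 * volume.real (ball (0 : Space3) R) with hC
    have hC0 : 0 ≤ C := by positivity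
    rw [Metric.tendsto_atTop]
    intro ε hε
    -- The final bound is `M * C` times this tolerance, hence below `ε`; the `+ 1` keeps the
    -- denominator positive.
    obtain ⟨r, hrR, hr⟩ := hflux (ε / (2 * (M * C + 1))) (by positivity)
    have hr0 : 0 < R ^ 2 - (max r 0) ^ 2 := by
      have : max r 0 < R := max_lt hrR hR
      nlinarith [le_max_right r 0]
    -- The first bound controls the mass of the slope; the second puts its support where `‖x‖ > r`.
    -- The radius `r` may be negative, hence `max r 0`.
    obtain ⟨N, hN⟩ := exists_nat_gt (max (4 / R ^ 2) (2 / (R ^ 2 - (max r 0) ^ 2)))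
    refine ⟨N, fun n hn => ?_⟩
    have hnN : max (4 / R ^ 2) (2 / (R ^ 2 - (max r 0) ^ 2)) < (n : ℝ) :=
      hN.trans_le (by exact_mod_cast hn)
    have hn1 := (le_max_left _ _).trans_lt hnN
    have hn2 := (le_max_right _ _).trans_lt hnN
    have hn0 : (0 : ℝ) < n := lt_trans (by positivity) hn1
    have hpt : ∀ x ∈ ball (0 : Space3) R,
        ‖inner ℝ (F x) ((-(ψ x * radialCutoffSlope R n x)) • x)‖
          ≤ M * (ε / (2 * (M * C + 1))) * radialCutoffSlope R n x := by
      intro x hx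
      have hxR : ‖x‖ < R := by simpa using hx
      by_cases h : R ^ 2 - ‖x‖ ^ 2 > 2 / n
      · simp [radialCutoffSlope_eq_zero h]
      · have hxr : r < ‖x‖ := by
          by_contra! hlt
          have h5 : ‖x‖ ^ 2 ≤ (max r 0) ^ 2 := by
            have := hlt.trans (le_max_left r 0)
            gcongr
          rw [div_lt_comm₀ hr0 hn0] at hn2
          linarith
        rw [real_inner_smul_right, norm_mul, norm_neg, norm_mul,
          Real.norm_of_nonneg (radialCutoffSlope_nonneg x)]
        have h6 : ‖inner ℝ (F x) x‖ ≤ _ := hr x hxr hxR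
        have h7 : ‖ψ x‖ ≤ M := hψM x hx
        have h8 := radialCutoffSlope_nonneg (R := R) (n := n) x
        calc _ ≤ M * radialCutoffSlope R n x * (ε / (2 * (M * C + 1))) := by gcongr
          _ = _ := by ring
    rw [dist_zero_right]
    have hint := integrable_radialCutoffSlope (n := n) hR
    calc _ ≤ ∫ x in ball (0 : Space3) R,
          M * (ε / (2 * (M * C + 1))) * radialCutoffSlope R n x := by
          refine norm_integral_le_of_norm_le (hint.integrableOn.const_mul _) ?_
          filter_upwards [ae_restrict_mem measurableSet_ball] with x hx using hpt x hx
      _ = M * (ε / (2 * (M * C + 1))) * ∫ x in ball (0 : Space3) R, radialCutoffSlope R n x :=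
          integral_const_mul _ _
      _ ≤ M * (ε / (2 * (M * C + 1))) * C := by
          gcongr
          exact (setIntegral_le_integral hint (.of_forall radialCutoffSlope_nonneg)).trans
            (integral_radialCutoffSlope_le hR hn1)
      _ < ε := by
          have : M * (ε / (2 * (M * C + 1))) * C = ε * (M * C / (2 * (M * C + 1))) := by ring
          rw [this]
          have h9 : 0 ≤ M * C := by positivity
          have : M * C / (2 * (M * C + 1)) < 1 := by
            rw [div_lt_one (by positivity)]; linarith
          nlinarith
  refine tendsto_nhds_unique hlim1 ?_
  have hlim3 : Tendsto (fun n : ℕ => c * (radialCutoff R n a * ψ a - radialCutoff R n b * ψ b))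
      atTop (𝓝 (c * (ψ a - ψ b))) := by
    refine tendsto_const_nhds.congr' ?_
    filter_upwards [eventually_radialCutoff_eq_one ha, eventually_radialCutoff_eq_one hb]
      with n h1 h2
    simp [h1, h2]
  simpa only [hsplit, sub_zero] using hlim3.sub hlim2

end

/-! ### The Coulomb field in the ball: integrability and weak Gauss law. -/

theorem norm_coulombField (e : ℝ) (a x : Space3) :
    ‖coulombField e a x‖ = |e| / (4 * Real.pi) * (‖x - a‖ ^ 2)⁻¹ := by
  have := Real.pi_pos
  rw [coulombField, norm_smul, Real.norm_eq_abs, abs_div, abs_of_nonneg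
    (a := 4 * Real.pi * ‖x - a‖ ^ 3) (by positivity)]
  by_cases h : ‖x - a‖ = 0
  · simp [h]
  · field_simp

theorem measurable_coulombField (e : ℝ) (a : Space3) : Measurable (coulombField e a) := by
  unfold coulombField
  fun_prop

theorem integrableOn_coulombField (e : ℝ) (a : Space3) (R : ℝ) :
    IntegrableOn (coulombField e a) (ball 0 R) := by
  have h1 : IntegrableOn (fun x : Space3 => (‖x‖ ^ 2)⁻¹) (ball 0 (R + ‖a‖)) := by
    -- In polar coordinates the radial integrand is the constant `1`.
    rw [integrableOn_fun_norm_addHaar volume (f := fun r : ℝ => (r ^ 2)⁻¹), finrank_euclideanSpace_fin]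
    refine (integrableOn_const (C := (1 : ℝ)) (by simp)).congr_fun
      (fun r hr => ?_) measurableSet_Ioo
    have : r ≠ 0 := hr.1.ne'
    simp [this]
  have h2 : Integrable (fun x : Space3 => (ball 0 (R + ‖a‖)).indicator (fun x => (‖x‖ ^ 2)⁻¹) (x - a)) :=
    ((integrable_indicator_iff measurableSet_ball).2 h1).comp_sub_right a
  refine Integrable.mono' (h2.integrableOn.const_mul (|e| / (4 * Real.pi)))
    (measurable_coulombField e a).aestronglyMeasurable ?_
  filter_upwards [ae_restrict_mem measurableSet_ball] with x hx
  have hx' : x - a ∈ ball (0 : Space3) (R + ‖a‖) := by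
    rw [mem_ball_zero_iff] at *
    linarith [norm_sub_le x a]
  rw [norm_coulombField, indicator_of_mem hx']

theorem setIntegral_ball_inner_gradient {R : ℝ} {χ : Space3 → ℝ}
    (hs : tsupport χ ⊆ ball 0 R) (F : Space3 → Space3) :
    ∫ x in ball (0 : Space3) R, inner ℝ (F x) (gradient χ x)
      = ∫ x, inner ℝ (F x) (gradient χ x) := by
  refine setIntegral_eq_integral_of_forall_compl_eq_zero fun x hx => ?_
  have h0 := (notMem_tsupport_iff_eventuallyEq.1 fun h => hx (hs h)).gradient_eq
  have : gradient (0 : Space3 → ℝ) x = 0 := gradient_const x 0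
  rw [h0, this, inner_zero_right]

theorem continuous_gradient {χ : Space3 → ℝ} (hχ : ContDiff ℝ 1 χ) : Continuous (gradient χ) :=
  continuousOn_univ.1 (continuousOn_gradient isOpen_univ hχ.contDiffOn)

theorem hasCompactSupport_gradient {χ : Space3 → ℝ} (hc : HasCompactSupport χ) :
    HasCompactSupport (gradient χ) :=
  (hc.fderiv ℝ).comp_left (g := (InnerProductSpace.toDual ℝ Space3).symm) (map_zero _)

theorem integrableOn_ball_inner_gradient {R : ℝ} {F : Space3 → Space3} {χ : Space3 → ℝ}
    (hF : IntegrableOn F (ball 0 R)) (hχ : ContDiff ℝ 1 χ) (hc : HasCompactSupport χ) :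
    IntegrableOn (fun x => inner ℝ (F x) (gradient χ x)) (ball 0 R) := by
  obtain ⟨M, hM⟩ := (hasCompactSupport_gradient hc).exists_bound_of_continuous
    (continuous_gradient hχ)
  exact IntegrableOn.inner_of_bounded measurableSet_ball hF (continuous_gradient hχ).continuousOn
    fun x _ => hM x

theorem integral_ball_inner_coulombField_gradient {R e : ℝ} {a : Space3} {χ : Space3 → ℝ}
    (hχ : ContDiff ℝ 1 χ) (hc : HasCompactSupport χ) (hs : tsupport χ ⊆ ball 0 R) :
    ∫ x in ball (0 : Space3) R, inner ℝ (coulombField e a x) (gradient χ x) = -(e * χ a) := by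
  rw [setIntegral_ball_inner_gradient hs]
  have hall : ∀ x, HasGradientAt χ (gradient χ x) x := fun x =>
    (hχ.differentiable one_ne_zero x).hasGradientAt
  refine integral_inner_coulombField e a hχ.continuous (fun w _ => by simp [hall]) ?_ ?_
  · exact hc.is_zero_at_infty
  · rw [← integrableOn_iff_integrable_of_support_subset (s := ball (0 : Space3) R)]
    · exact integrableOn_ball_inner_gradient (integrableOn_coulombField e a R) hχ hc
    · intro x hx
      by_contra h
      have h0 := (notMem_tsupport_iff_eventuallyEq.1 fun h' => h (hs h')).gradient_eq
      have : gradient (0 : Space3 → ℝ) x = 0 := gradient_const x 0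
      exact hx (by simp only [h0, this, inner_zero_right])

/-! ### The image charge and the explicit regular field. -/

section

variable {R e : ℝ} {a x : Space3}

/-- The distance `√(R⁴ - 2 R² x·a + |a|² |x|²)` from `x` to the image charge, times `|a|`. -/
noncomputable def imageDist (R : ℝ) (a x : Space3) : ℝ :=
  √(R ^ 4 - 2 * R ^ 2 * inner ℝ x a + ‖a‖ ^ 2 * ‖x‖ ^ 2)

/-- The vector from the image charge to `x`, times `|a|²`. -/
noncomputable def imageVec (R : ℝ) (a x : Space3) : Space3 := ‖a‖ ^ 2 • x - R ^ 2 • a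

/-- The argument of the logarithm in the Neumann function of the ball. -/
noncomputable def imageLog (R : ℝ) (a x : Space3) : ℝ := R ^ 2 - inner ℝ x a + imageDist R a x

/-- The regular part of the Neumann potential of a point charge in the ball. -/
noncomputable def regPotential (R e : ℝ) (a x : Space3) : ℝ :=
  e / (4 * Real.pi) * (R * (imageDist R a x)⁻¹ - R⁻¹ * Real.log (imageLog R a x))

/-- The regular part of the Neumann field of a point charge in the ball. -/
noncomputable def regField (R e : ℝ) (a x : Space3) : Space3 :=
  (e / (4 * Real.pi)) • ((R * (imageDist R a x ^ 3)⁻¹) • imageVec R a x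
    + (R⁻¹ * (imageLog R a x)⁻¹) • ((imageDist R a x)⁻¹ • imageVec R a x - a))

/-- This strict inequality keeps `imageDist` and `imageLog` positive up to the boundary of the ball.
-/
theorem inner_lt_sq_of_mem_ball (ha : a ∈ ball (0 : Space3) R)
    (hx : x ∈ closedBall (0 : Space3) R) : ‖a‖ * ‖x‖ < R ^ 2 := by
  rw [mem_ball_zero_iff] at ha
  rw [mem_closedBall_zero_iff] at hx
  have hR : 0 < R := (norm_nonneg a).trans_lt ha
  nlinarith [norm_nonneg a, norm_nonneg x]

theorem imageDist_pos (ha : a ∈ ball (0 : Space3) R) (hx : x ∈ closedBall (0 : Space3) R) :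
    0 < imageDist R a x := by
  have h := inner_lt_sq_of_mem_ball ha hx
  refine Real.sqrt_pos.2 ?_
  have h2 : inner ℝ x a ≤ ‖x‖ * ‖a‖ := real_inner_le_norm x a
  nlinarith [sq_nonneg R, sq_pos_of_pos (sub_pos.2 h)]

theorem imageDist_sq (ha : a ∈ ball (0 : Space3) R) (hx : x ∈ closedBall (0 : Space3) R) :
    imageDist R a x ^ 2 = R ^ 4 - 2 * R ^ 2 * inner ℝ x a + ‖a‖ ^ 2 * ‖x‖ ^ 2 :=
  Real.sq_sqrt (Real.sqrt_pos.1 (imageDist_pos ha hx)).le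

theorem imageLog_pos (ha : a ∈ ball (0 : Space3) R) (hx : x ∈ closedBall (0 : Space3) R) :
    0 < imageLog R a x := by
  have h := inner_lt_sq_of_mem_ball ha hx
  have h2 : inner ℝ x a ≤ ‖x‖ * ‖a‖ := real_inner_le_norm x a
  have := imageDist_pos ha hx
  unfold imageLog
  linarith [mul_comm ‖a‖ ‖x‖]

theorem contDiffAt_imageDist (ha : a ∈ ball (0 : Space3) R) (hx : x ∈ closedBall (0 : Space3) R)
    {n : ℕ∞} : ContDiffAt ℝ n (imageDist R a) x := by
  refine ContDiffAt.sqrt ?_ (Real.sqrt_pos.1 (imageDist_pos ha hx)).ne'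
  have h1 : ContDiffAt ℝ n (fun x : Space3 => inner ℝ x a) x := contDiffAt_id.inner ℝ contDiffAt_const
  have h2 : ContDiffAt ℝ n (fun x : Space3 => ‖x‖ ^ 2) x := contDiffAt_id.norm_sq ℝ
  fun_prop

theorem contDiffAt_imageLog (ha : a ∈ ball (0 : Space3) R) (hx : x ∈ closedBall (0 : Space3) R)
    {n : ℕ∞} : ContDiffAt ℝ n (imageLog R a) x := by
  have h1 : ContDiffAt ℝ n (fun x : Space3 => inner ℝ x a) x := contDiffAt_id.inner ℝ contDiffAt_const
  exact (contDiffAt_const.sub h1).add (contDiffAt_imageDist ha hx)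

theorem contDiffAt_imageVec {n : ℕ∞} : ContDiffAt ℝ n (imageVec R a) x := by
  unfold imageVec
  fun_prop

theorem contDiffAt_regPotential (ha : a ∈ ball (0 : Space3) R)
    (hx : x ∈ closedBall (0 : Space3) R) {n : ℕ∞} : ContDiffAt ℝ n (regPotential R e a) x := by
  have h1 := (contDiffAt_imageDist ha hx (n := n)).inv (imageDist_pos ha hx).ne'
  have h2 := (contDiffAt_imageLog ha hx (n := n)).log (imageLog_pos ha hx).ne'
  exact contDiffAt_const.mul ((contDiffAt_const.mul h1).sub (contDiffAt_const.mul h2))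

theorem contDiffAt_regField (ha : a ∈ ball (0 : Space3) R)
    (hx : x ∈ closedBall (0 : Space3) R) {n : ℕ∞} : ContDiffAt ℝ n (regField R e a) x := by
  have hS := contDiffAt_imageDist ha hx (n := n)
  have hS0 := (imageDist_pos ha hx).ne'
  have h1 := (hS.pow 3).inv (pow_ne_zero 3 hS0)
  have h2 := (contDiffAt_imageLog ha hx (n := n)).inv (imageLog_pos ha hx).ne'
  have hv := contDiffAt_imageVec (R := R) (a := a) (x := x) (n := n)
  exact (((contDiffAt_const.mul h1).smul hv).add
    ((contDiffAt_const.mul h2).smul (((hS.inv hS0).smul hv).sub contDiffAt_const))).const_smul _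

theorem hasGradientAt_imageDist (ha : a ∈ ball (0 : Space3) R)
    (hx : x ∈ closedBall (0 : Space3) R) :
    HasGradientAt (imageDist R a) ((imageDist R a x)⁻¹ • imageVec R a x) x := by
  have hS := imageDist_pos ha hx
  have h1 := (((hasGradientAt_const x (R ^ 4)).sub
    ((hasGradientAt_inner_right a x).const_mul (2 * R ^ 2))).add
    ((hasGradientAt_norm_sq x).const_mul (‖a‖ ^ 2)))
  have h2 := (Real.hasDerivAt_sqrt (Real.sqrt_pos.1 hS).ne').comp_hasGradientAt x h1
  have h3 : HasGradientAt (imageDist R a) _ x := h2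
  convert h3 using 1
  change _ = (1 / (2 * imageDist R a x)) • _
  rw [imageVec, zero_sub, smul_add, smul_sub, smul_neg, smul_smul, smul_smul, smul_smul, smul_smul,
    smul_smul, neg_add_eq_sub]
  congr 2 <;> field_simp

theorem hasGradientAt_imageLog (ha : a ∈ ball (0 : Space3) R)
    (hx : x ∈ closedBall (0 : Space3) R) :
    HasGradientAt (imageLog R a) ((imageDist R a x)⁻¹ • imageVec R a x - a) x := by
  have h : HasGradientAt (imageLog R a) _ x := ((hasGradientAt_const x (R ^ 2)).sub
    (hasGradientAt_inner_right a x)).add (hasGradientAt_imageDist ha hx)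
  convert h using 1
  abel

theorem hasGradientAt_regPotential (ha : a ∈ ball (0 : Space3) R)
    (hx : x ∈ closedBall (0 : Space3) R) :
    HasGradientAt (regPotential R e a) (-(regField R e a x)) x := by
  have hS := imageDist_pos ha hx
  have hL := imageLog_pos ha hx
  have h1 := (hasDerivAt_inv hS.ne').comp_hasGradientAt x (hasGradientAt_imageDist ha hx)
  have h2 := (Real.hasDerivAt_log hL.ne').comp_hasGradientAt x (hasGradientAt_imageLog ha hx)
  have h : HasGradientAt (regPotential R e a) _ x :=
    ((h1.const_mul R).sub (h2.const_mul R⁻¹)).const_mul (e / (4 * Real.pi))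
  convert h using 1
  rw [regField, ← smul_neg]
  congr 1
  rw [neg_add, ← sub_eq_add_neg, smul_smul, smul_smul, smul_smul, ← neg_smul]
  congr 2
  field_simp

theorem inner_imageVec_self (ha : a ∈ ball (0 : Space3) R) (hx : x ∈ closedBall (0 : Space3) R) :
    inner ℝ (imageVec R a x) (imageVec R a x) = ‖a‖ ^ 2 * imageDist R a x ^ 2 := by
  rw [imageDist_sq ha hx, imageVec]
  simp only [inner_sub_left, inner_sub_right, real_inner_smul_left, real_inner_smul_right,
    real_inner_comm a x]
  rw [real_inner_self_eq_norm_sq, real_inner_self_eq_norm_sq]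
  ring

theorem inner_imageVec_left (y : Space3) :
    inner ℝ (imageVec R a x) y = ‖a‖ ^ 2 * inner ℝ x y - R ^ 2 * inner ℝ a y := by
  simp [imageVec, inner_sub_left, real_inner_smul_left]

theorem divergence_imageVec : divergence (imageVec R a) x = 3 * ‖a‖ ^ 2 := by
  have h := divergence_add (F := fun y => ‖a‖ ^ 2 • y) (G := fun _ => -(R ^ 2 • a)) (x := x)
    (by fun_prop) (by fun_prop)
  rw [divergence_const, divergence_const_smul _ differentiableAt_fun_id, divergence_id] at h
  simp only [← sub_eq_add_neg] at h
  rw [show imageVec R a = fun y => ‖a‖ ^ 2 • y - R ^ 2 • a from rfl, h]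
  ring

/-- Both parts are separately divergence-free. With `S = imageDist`, `v = imageVec` and `L =
imageLog`, the image term vanishes because `div v = 3|a|²` and `|v|² = |a|² S²`. The logarithmic
term vanishes because `ΔL = 2|a|²/S` and `|∇L|² = 2|a|² L/S`, so that `L ΔL = |∇L|²`. -/
theorem divergence_regField (hR : 0 < R) (ha : a ∈ ball (0 : Space3) R)
    (hx : x ∈ closedBall (0 : Space3) R) : divergence (regField R e a) x = 0 := by
  have hS := imageDist_pos ha hx
  have hL := imageLog_pos ha hx
  have hSd := (contDiffAt_imageDist ha hx (n := 1)).differentiableAt one_ne_zero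
  have hLd := (contDiffAt_imageLog ha hx (n := 1)).differentiableAt one_ne_zero
  have hv := (contDiffAt_imageVec (R := R) (a := a) (x := x) (n := 1)).differentiableAt one_ne_zero
  have hSg := hasGradientAt_imageDist ha hx
  have hLg := hasGradientAt_imageLog ha hx
  have hcub : HasDerivAt (fun s : ℝ => R * (s ^ 3)⁻¹) (-(3 * R / imageDist R a x ^ 4))
      (imageDist R a x) := by
    refine (((hasDerivAt_pow 3 (imageDist R a x)).fun_inv
      (pow_ne_zero 3 hS.ne')).const_mul R).congr_deriv ?_
    field_simp
    norm_num
    ring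
  have hS3 := hcub.comp_hasGradientAt x hSg
  have hL1 := ((hasDerivAt_inv hL.ne').const_mul R⁻¹).comp_hasGradientAt x hLg
  have hS1 := (hasDerivAt_inv hS.ne').comp_hasGradientAt x hSg
  have hw : DifferentiableAt ℝ (fun y => (imageDist R a y)⁻¹ • imageVec R a y) x :=
    (hSd.inv hS.ne').smul hv
  have hw' : DifferentiableAt ℝ (fun y => (imageDist R a y)⁻¹ • imageVec R a y + -a) x :=
    hw.add_const _
  have hA : DifferentiableAt ℝ (fun y => (R * (imageDist R a y ^ 3)⁻¹) • imageVec R a y) x :=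
    hS3.differentiableAt.smul hv
  have hB : DifferentiableAt ℝ (fun y => (R⁻¹ * (imageLog R a y)⁻¹) •
      ((imageDist R a y)⁻¹ • imageVec R a y + -a)) x := hL1.differentiableAt.smul hw'
  have hvv := inner_imageVec_self ha hx
  have hva : inner ℝ (imageVec R a x) a = ‖a‖ ^ 2 * (inner ℝ x a - R ^ 2) := by
    rw [inner_imageVec_left, real_inner_self_eq_norm_sq]
    ring
  have hLdef : imageLog R a x = R ^ 2 - inner ℝ x a + imageDist R a x := rfl
  have hreg : regField R e a = fun y => (e / (4 * Real.pi)) •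
      ((R * (imageDist R a y ^ 3)⁻¹) • imageVec R a y
    + (R⁻¹ * (imageLog R a y)⁻¹) • ((imageDist R a y)⁻¹ • imageVec R a y + -a)) := by
    funext y; rw [regField, sub_eq_add_neg]
  have hdivw : divergence (fun y => (imageDist R a y)⁻¹ • imageVec R a y + -a) x
      = 2 * ‖a‖ ^ 2 / imageDist R a x := by
    rw [divergence_add hw (differentiableAt_const _), divergence_const, divergence_smul hS1 hv,
      divergence_imageVec, real_inner_smul_left, real_inner_smul_left, hvv]
    field_simp
    ring
  rw [hreg, divergence_const_smul _ (hA.fun_add hB), divergence_add hA hB, divergence_smul hS3 hv,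
    divergence_smul hL1 hw', hdivw, divergence_imageVec, ← sub_eq_add_neg]
  simp only [real_inner_smul_left, real_inner_smul_right, inner_sub_left, inner_sub_right, hvv,
    real_inner_comm (imageVec R a x) a, hva]
  rw [real_inner_self_eq_norm_sq]
  generalize imageDist R a x = S at *
  generalize imageLog R a x = L at *
  have ht : inner ℝ x a = R ^ 2 + S - L := by linarith
  rw [ht]
  field_simp
  ring

/-- On the sphere `imageDist = R ‖x - a‖`. The charge and its image together contribute `R/S` and
the logarithm contributes `1/R - R/S`, up to the factor `e/(4π)`; the dependence on `x` cancels. -/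
theorem inner_regField_sphere (hR : 0 < R) (ha : a ∈ ball (0 : Space3) R)
    (hx : x ∈ sphere (0 : Space3) R) :
    inner ℝ (coulombField e a x + regField R e a x) x = e / (4 * Real.pi * R) := by
  have hx' := sphere_subset_closedBall hx
  have hS := imageDist_pos ha hx'
  have hL := imageLog_pos ha hx'
  have hxR : ‖x‖ = R := by simpa using hx
  have hS2 := imageDist_sq ha hx'
  have hLdef : imageLog R a x = R ^ 2 - inner ℝ x a + imageDist R a x := rfl
  have hd : ‖x - a‖ = imageDist R a x / R := by
    rw [eq_div_iff hR.ne', ← sq_eq_sq₀ (by positivity) hS.le, mul_pow, norm_sub_sq_real, hS2, hxR]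
    ring
  have hpi := Real.pi_pos
  rw [coulombField, regField, hd, inner_add_left, real_inner_smul_left, real_inner_smul_left,
    inner_add_left, real_inner_smul_left, real_inner_smul_left, inner_sub_left, inner_sub_left,
    real_inner_smul_left, inner_imageVec_left, real_inner_self_eq_norm_sq,
    real_inner_comm x a, hxR]
  rw [hxR] at hS2
  set S := imageDist R a x
  set L := imageLog R a x
  set t := inner ℝ x a
  have k1 : R⁻¹ * L⁻¹ * (S⁻¹ * (‖a‖ ^ 2 * R ^ 2 - R ^ 2 * t) - t) = 1 / R - R / S := by
    rw [hLdef] at hL ⊢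
    field_simp
    linear_combination (-1 : ℝ) * hS2
  have k2 : (R / S) ^ 3 * (R ^ 2 - t) + R * (S ^ 3)⁻¹ * (‖a‖ ^ 2 * R ^ 2 - R ^ 2 * t) = R / S := by
    field_simp
    linear_combination (-1 : ℝ) * hS2
  have k3 : e / (4 * Real.pi * (S / R) ^ 3) * (R ^ 2 - t)
      = e / (4 * Real.pi) * ((R / S) ^ 3 * (R ^ 2 - t)) := by
    field_simp
  rw [k1, k3, ← mul_add, ← add_assoc, k2]
  field_simp
  ring

end

/-! ### Existence and uniqueness for the Neumann problem. -/

section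

variable {R e : ℝ} {a : Space3}

/-- The points of the closed shell with `|G| ≥ ε` form a compact set that misses the sphere, so
their norms have a maximum below `R`. A shell is used because the fields in question are singular
inside the ball. -/
theorem exists_radius_abs_le_of_eq_zero_on_sphere {G : Space3 → ℝ} {r₀ : ℝ} (hr₀ : r₀ < R)
    (hG : ContinuousOn G {x | r₀ ≤ ‖x‖ ∧ ‖x‖ ≤ R}) (h0 : ∀ x ∈ sphere (0 : Space3) R, G x = 0)
    {ε : ℝ} (hε : 0 < ε) : ∃ r < R, ∀ x, r < ‖x‖ → ‖x‖ < R → |G x| ≤ ε := by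
  set K := {x : Space3 | r₀ ≤ ‖x‖ ∧ ‖x‖ ≤ R}
  have hKc : IsClosed K := (isClosed_le continuous_const continuous_norm).inter
    (isClosed_le continuous_norm continuous_const)
  have hC : IsCompact (K ∩ (fun x => |G x|) ⁻¹' Ici ε) := by
    refine (isCompact_closedBall (0 : Space3) R).of_isClosed_subset
      (hG.abs.preimage_isClosed_of_isClosed hKc isClosed_Ici) fun x hx => ?_
    simpa using hx.1.2
  rcases (K ∩ (fun x => |G x|) ⁻¹' Ici ε).eq_empty_or_nonempty with hempty | hne
  · refine ⟨r₀, hr₀, fun x h1 h2 => ?_⟩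
    by_contra! h
    have : x ∈ K ∩ (fun x => |G x|) ⁻¹' Ici ε := ⟨⟨h1.le, h2.le⟩, h.le⟩
    simp [hempty] at this
  · obtain ⟨y, hy, hmax⟩ := hC.exists_isMaxOn hne continuous_norm.continuousOn
    have hyR : ‖y‖ < R := by
      refine lt_of_le_of_ne hy.1.2 fun h => ?_
      have h1 : ε ≤ |G y| := hy.2
      rw [h0 y (by simpa using h), abs_zero] at h1
      linarith
    refine ⟨max r₀ ‖y‖, max_lt hr₀ hyR, fun x h1 h2 => ?_⟩
    by_contra! h
    have : ‖x‖ ≤ ‖y‖ := hmax ⟨⟨(le_max_left _ _).trans h1.le, h2.le⟩, h.le⟩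
    linarith [le_max_right r₀ ‖y‖]

theorem continuousAt_coulombField {x : Space3} (hx : x ≠ a) :
    ContinuousAt (coulombField e a) x := by
  have h : 4 * Real.pi * ‖x - a‖ ^ 3 ≠ 0 := by
    have := Real.pi_pos
    have := norm_pos_iff.2 (sub_ne_zero.2 hx)
    positivity
  unfold coulombField
  have h1 : ContinuousAt (fun x : Space3 => 4 * Real.pi * ‖x - a‖ ^ 3) x := by fun_prop
  exact (continuousAt_const.div h1 h).smul (by fun_prop)

theorem continuousOn_regField (ha : a ∈ ball (0 : Space3) R) :
    ContinuousOn (regField R e a) (closedBall 0 R) := fun _ hx =>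
  (contDiffAt_regField ha hx (n := 0)).continuousAt.continuousWithinAt

theorem contDiffOn_regField (ha : a ∈ ball (0 : Space3) R) {n : ℕ∞} :
    ContDiffOn ℝ n (regField R e a) (ball 0 R) := fun _ hx =>
  (contDiffAt_regField ha (ball_subset_closedBall hx)).contDiffWithinAt

theorem integrableOn_of_continuousOn_closedBall {F : Space3 → Space3}
    (hF : ContinuousOn F (closedBall 0 R)) : IntegrableOn F (ball 0 R) :=
  (hF.integrableOn_compact (isCompact_closedBall _ _)).mono_set ball_subset_closedBall

theorem integral_ball_inner_gradient_of_divergence_eq_zero {F : Space3 → Space3}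
    {χ : Space3 → ℝ} (hF : ContDiffOn ℝ 1 F (ball 0 R))
    (hd : ∀ x ∈ ball (0 : Space3) R, divergence F x = 0) (hχ : ContDiff ℝ 1 χ)
    (hc : HasCompactSupport χ) (hs : tsupport χ ⊆ ball 0 R) :
    ∫ x in ball (0 : Space3) R, inner ℝ (F x) (gradient χ x) = 0 := by
  rw [setIntegral_ball_inner_gradient hs,
    integral_inner_gradient_eq_neg_divergence isOpen_ball hF hχ hc hs, neg_eq_zero]
  refine integral_eq_zero_of_ae (.of_forall fun x => ?_)
  by_cases hx : x ∈ ball (0 : Space3) R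
  · simp [hd x hx]
  · simp [image_eq_zero_of_notMem_tsupport fun h => hx (hs h)]

theorem integral_ball_inner_totalField_gradient {D : Space3 → Space3}
    (hDc : ContinuousOn D (closedBall 0 R)) (hD : ContDiffOn ℝ 1 D (ball 0 R))
    (hd : ∀ x ∈ ball (0 : Space3) R, divergence D x = 0) {χ : Space3 → ℝ} (hχ : ContDiff ℝ 1 χ)
    (hc : HasCompactSupport χ) (hs : tsupport χ ⊆ ball 0 R) :
    ∫ x in ball (0 : Space3) R, inner ℝ (totalField e a D x) (gradient χ x) = -(e * χ a) := by
  simp only [totalField, inner_add_left]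
  rw [integral_add, integral_ball_inner_coulombField_gradient hχ hc hs,
    integral_ball_inner_gradient_of_divergence_eq_zero hD hd hχ hc hs, add_zero]
  · exact integrableOn_ball_inner_gradient (integrableOn_coulombField e a R) hχ hc
  · exact integrableOn_ball_inner_gradient (integrableOn_of_continuousOn_closedBall hDc) hχ hc

theorem isNeumannSolution_regField (hR : 0 < R) (ha : a ∈ ball (0 : Space3) R) (E : Space3) :
    IsNeumannSolution R e a E (fun x => regPotential R e a x - inner ℝ x E)
      (fun x => regField R e a x + E) where
  contDiffOn x hx := by
    have h1 : ContDiffAt ℝ 2 (fun x : Space3 => inner ℝ x E) x :=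
      contDiffAt_id.inner ℝ contDiffAt_const
    exact ((contDiffAt_regPotential ha (ball_subset_closedBall hx) (n := 2)).sub
      h1).contDiffWithinAt
  hasGradientAt x hx := by
    have h := (hasGradientAt_regPotential (e := e) ha (ball_subset_closedBall hx)).sub
      (hasGradientAt_inner_right E x)
    rwa [← neg_add'] at h
  continuousOn := (continuousOn_regField ha).add continuousOn_const
  gauss ψ hψ hc hs := by
    refine integral_ball_inner_totalField_gradient
      ((continuousOn_regField ha).add continuousOn_const)
      ((contDiffOn_regField ha).add contDiffOn_const) (fun x hx => ?_) (hψ.of_le (by simp)) hc hs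
    change divergence (fun y => regField R e a y + E) x = 0
    rw [divergence_add ((contDiffAt_regField ha (ball_subset_closedBall hx)
      (n := 1)).differentiableAt one_ne_zero) (differentiableAt_const _),
      divergence_regField hR ha (ball_subset_closedBall hx), divergence_const, add_zero]
  neumann x hx := by
    have h := inner_regField_sphere (e := e) hR ha hx
    have := Real.pi_pos
    rw [totalField, ← add_assoc, inner_add_left, real_inner_smul_right, h, add_comm]
    field_simp

theorem IsNeumannSolution.eqOn {E : Space3} {φ φ' : Space3 → ℝ} {D D' : Space3 → Space3}
    (hR : 0 < R) (h : IsNeumannSolution R e a E φ D) (h' : IsNeumannSolution R e a E φ' D') :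
    EqOn D D' (closedBall 0 R) := by
  set w : Space3 → ℝ := fun x => φ x - φ' x
  set F : Space3 → Space3 := fun x => D x - D' x
  have hFc : ContinuousOn F (closedBall 0 R) := h.continuousOn.sub h'.continuousOn
  have hw : ContDiffOn ℝ 2 w (ball 0 R) := h.contDiffOn.sub h'.contDiffOn
  have hgrad : ∀ x ∈ ball (0 : Space3) R, HasGradientAt w (-(F x)) x := fun x hx => by
    have := (h.hasGradientAt x hx).sub (h'.hasGradientAt x hx)
    rwa [neg_sub_neg, ← neg_sub] at this
  have hF1 : ContDiffOn ℝ 1 F (ball 0 R) := by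
    have h1 : ContDiffOn ℝ 1 (gradient w) (ball 0 R) :=
      (InnerProductSpace.toDual ℝ Space3).symm.contDiff.comp_contDiffOn
        (hw.fderiv_of_isOpen isOpen_ball (by norm_num))
    refine h1.neg.congr fun x hx => ?_
    rw [(hgrad x hx).gradient, neg_neg]
  have hdivc : ContinuousOn (divergence F) (ball 0 R) := by
    unfold divergence
    refine continuousOn_finsetSum _ fun i _ => ?_
    exact (EuclideanSpace.proj (𝕜 := ℝ) i).continuous.comp_continuousOn
      ((hF1.continuousOn_fderiv_of_isOpen isOpen_ball le_rfl).clm_apply continuousOn_const)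
  -- In the difference of the two weak Gauss laws the point charge disappears; the fundamental lemma
  -- of the calculus of variations then makes the continuous divergence vanish pointwise.
  have hweak : ∀ ψ : Space3 → ℝ, ContDiff ℝ ∞ ψ → HasCompactSupport ψ →
      tsupport ψ ⊆ ball (0 : Space3) R → ∫ x, ψ x • divergence F x = 0 := by
    intro ψ hψ hc hs
    have hψ1 : ContDiff ℝ 1 ψ := hψ.of_le (by simp)
    have hi : ∀ {φ D}, IsNeumannSolution R e a E φ D → IntegrableOn
        (fun x => inner ℝ (totalField e a D x) (gradient ψ x)) (ball 0 R) := fun h =>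
      integrableOn_ball_inner_gradient ((integrableOn_coulombField e a R).add
        (integrableOn_of_continuousOn_closedBall h.continuousOn)) hψ1 hc
    have h1 := integral_sub (hi h) (hi h')
    rw [h.gauss ψ hψ hc hs, h'.gauss ψ hψ hc hs, sub_self] at h1
    have h2 : ∀ x, inner ℝ (totalField e a D x) (gradient ψ x)
        - inner ℝ (totalField e a D' x) (gradient ψ x) = inner ℝ (F x) (gradient ψ x) := fun x => by
      rw [← inner_sub_left]
      simp [totalField, F]
    simp only [h2] at h1
    rw [setIntegral_ball_inner_gradient hs,
      integral_inner_gradient_eq_neg_divergence isOpen_ball hF1 hψ1 hc hs, neg_eq_zero] at h1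
    simpa [mul_comm] using h1
  have hdiv : ∀ x ∈ ball (0 : Space3) R, divergence F x = 0 := by
    have hae := isOpen_ball.ae_eq_zero_of_integral_contDiff_smul_eq_zero
      (hdivc.locallyIntegrableOn measurableSet_ball) hweak
    exact Measure.eqOn_open_of_ae_eq ((ae_restrict_iff' measurableSet_ball).2 hae) isOpen_ball hdivc
      continuousOn_const
  obtain ⟨M, hM⟩ := (isCompact_closedBall (0 : Space3) R).exists_bound_of_continuousOn hFc
  have h0 : (0 : Space3) ∈ ball (0 : Space3) R := mem_ball_self hR
  have hM0 : 0 ≤ M := (norm_nonneg _).trans (hM 0 (ball_subset_closedBall h0))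
  -- The potentials are not assumed to extend to the boundary; the bounded gradient makes their
  -- difference bounded all the same.
  have hwM : ∀ x ∈ ball (0 : Space3) R, |w x| ≤ |w 0| + M * R := fun x hx => by
    have h1 := (convex_ball (0 : Space3) R).norm_image_sub_le_of_norm_hasFDerivWithin_le
      (fun y hy => (hgrad y hy).hasFDerivAt.hasFDerivWithinAt) (C := M)
      (fun y hy => by simpa using hM y (ball_subset_closedBall hy)) h0 hx
    have h2 : ‖x - 0‖ ≤ R := by simpa using (mem_ball_zero_iff.1 hx).le
    have h3 := abs_sub_abs_le_abs_sub (w x) (w 0)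
    have h4 : M * ‖x - 0‖ ≤ M * R := by gcongr
    rw [Real.norm_eq_abs] at h1
    linarith
  have hsphere : ∀ x ∈ sphere (0 : Space3) R, inner ℝ (F x) x = 0 := fun x hx => by
    have h1 := (h.neumann x hx).trans (h'.neumann x hx).symm
    rw [totalField, totalField, inner_add_left, inner_add_left, add_right_inj,
      real_inner_smul_right, real_inner_smul_right,
      mul_right_inj' (inv_ne_zero hR.ne')] at h1
    simp [F, inner_sub_left, h1]
  -- The test function is `w`, the potential of `F` itself, so the integral is minus the squared
  -- norm of `F`. There is no charge, so `c = 0` and the points are irrelevant.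
  have hzero := integral_ball_inner_gradient_of_zero_flux (c := 0) (M := |w 0| + M * R + M)
    hR h0 h0
    (fun χ hχ hc hs => by
      rw [integral_ball_inner_gradient_of_divergence_eq_zero hF1 hdiv hχ hc hs, zero_mul])
    (integrableOn_of_continuousOn_closedBall hFc)
    (fun ε hε => exists_radius_abs_le_of_eq_zero_on_sphere (r₀ := 0) hR
      (G := fun x => inner ℝ (F x) x)
      ((hFc.inner continuousOn_id).mono fun x hx => by simpa using hx.2) hsphere hε)
    (hw.of_le (by norm_num)) (fun x hx => (hwM x hx).trans (by linarith))
    (fun x hx => by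
      rw [(hgrad x hx).gradient, norm_neg]
      have := hM x (ball_subset_closedBall hx)
      have : 0 ≤ M * R := by positivity
      linarith [abs_nonneg (w 0)])
  have hsq : ∫ x in ball (0 : Space3) R, ‖F x‖ ^ 2 = 0 := by
    rw [zero_mul, ← neg_eq_zero, ← integral_neg] at hzero
    rw [← hzero]
    refine setIntegral_congr_fun measurableSet_ball fun x hx => ?_
    simp only [(hgrad x hx).gradient, inner_neg_right, neg_neg, real_inner_self_eq_norm_sq]
  have hFsq : ContinuousOn (fun x => ‖F x‖ ^ 2) (closedBall 0 R) := hFc.norm.pow 2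
  have hae : (fun x => ‖F x‖ ^ 2) =ᵐ[volume.restrict (ball 0 R)] fun _ => 0 :=
    (setIntegral_eq_zero_iff_of_nonneg_ae (.of_forall fun x => sq_nonneg _)
      ((hFsq.integrableOn_compact (isCompact_closedBall _ _)).mono_set ball_subset_closedBall)).1 hsq
  have heq := Measure.eqOn_open_of_ae_eq hae isOpen_ball (hFsq.mono ball_subset_closedBall)
    continuousOn_const
  have heq' : EqOn D D' (ball 0 R) := fun x hx => by
    have := heq hx
    simpa [F, sub_eq_zero] using this
  exact heq'.of_subset_closure h.continuousOn h'.continuousOn ball_subset_closedBall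
    (by rw [closure_ball _ hR.ne'])

end

/-! ### Exterior integrals, softened potentials and the zero-flux field. -/

section

variable {R e : ℝ} {a b : Space3}

theorem norm_coulombField_le (ha : a ∈ ball (0 : Space3) R) :
    ∃ C, ∀ x ∈ (ball (0 : Space3) R)ᶜ, ‖coulombField e a x‖ ≤ C * ((1 + ‖x‖) ^ 2)⁻¹ := by
  have haR : ‖a‖ < R := by simpa using ha
  have ha0 := norm_nonneg a
  -- The best constant in `‖x‖ - ‖a‖ ≥ c (1 + ‖x‖)` for `‖x‖ ≥ R`: equality holds at `‖x‖ = R`.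
  set c := (R - ‖a‖) / (1 + R)
  have hc : 0 < c := div_pos (by linarith) (by linarith)
  refine ⟨|e| / (4 * Real.pi) * (c ^ 2)⁻¹, fun x hx => ?_⟩
  have hxR : R ≤ ‖x‖ := by simpa using hx
  have h1 : c * (1 + ‖x‖) ≤ ‖x - a‖ := by
    refine le_trans ?_ (norm_sub_norm_le x a)
    rw [div_mul_eq_mul_div, div_le_iff₀ (by linarith)]
    nlinarith
  have h2 : (‖x - a‖ ^ 2)⁻¹ ≤ (c ^ 2)⁻¹ * ((1 + ‖x‖) ^ 2)⁻¹ := by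
    rw [← mul_inv, ← mul_pow]
    gcongr
  rw [norm_coulombField, mul_assoc]
  have := Real.pi_pos
  gcongr

theorem integrableOn_norm_coulombField_mul (ha : a ∈ ball (0 : Space3) R)
    (hb : b ∈ ball (0 : Space3) R) : IntegrableOn
      (fun x => ‖coulombField e a x‖ * ‖coulombField e b x‖) (ball (0 : Space3) R)ᶜ := by
  obtain ⟨C, hC⟩ := norm_coulombField_le (e := e) ha
  obtain ⟨C', hC'⟩ := norm_coulombField_le (e := e) hb
  have h := (integrable_one_add_norm (E := Space3) (μ := volume) (r := 4)
    (by rw [finrank_euclideanSpace_fin]; norm_num)).const_mul (C * C')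
  refine Integrable.mono' h.integrableOn (((measurable_coulombField e a).norm.mul
    (measurable_coulombField e b).norm).aestronglyMeasurable) ?_
  filter_upwards [ae_restrict_mem measurableSet_ball.compl] with x hx
  have h1 := hC x hx
  rw [norm_mul, norm_norm, norm_norm]
  refine (mul_le_mul h1 (hC' x hx) (norm_nonneg _) ((norm_nonneg _).trans h1)).trans_eq ?_
  have h2 : (1 + ‖x‖) ^ (-4 : ℝ) = ((1 + ‖x‖) ^ 2)⁻¹ * ((1 + ‖x‖) ^ 2)⁻¹ := by
    rw [Real.rpow_neg (by positivity), ← mul_inv]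
    norm_cast
    ring
  rw [h2]
  ring

/-- A line meets a sphere in at most two points: given one root `s`, Vieta's formula gives the
other. -/
theorem countable_setOf_norm_smul_add_eq {w : Space3} (hw : ‖w‖ = 1) (a : Space3) (R : ℝ) :
    {r : ℝ | ‖r • w + a‖ = R}.Countable := by
  have hq : ∀ r : ℝ, ‖r • w + a‖ ^ 2 = r ^ 2 + 2 * r * inner ℝ w a + ‖a‖ ^ 2 := fun r => by
    rw [norm_add_sq_real, norm_smul, hw, real_inner_smul_left, mul_one, Real.norm_eq_abs, sq_abs]
    ring
  rcases {r : ℝ | ‖r • w + a‖ = R}.eq_empty_or_nonempty with h | ⟨s, hs⟩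
  · simp [h]
  · refine (Set.toFinite {s, -2 * inner ℝ w a - s}).countable.mono fun r hr => ?_
    have h1 := hq r
    have h2 := hq s
    rw [show ‖r • w + a‖ = R from hr] at h1
    rw [show ‖s • w + a‖ = R from hs] at h2
    have h3 : (r - s) * (r - (-2 * inner ℝ w a - s)) = 0 := by linear_combination h2 - h1
    rcases mul_eq_zero.1 h3 with h | h
    · left; linarith
    · right; simp only [mem_singleton_iff]; linarith

/-- The Coulomb potential softened at the scale `ε`, with the sign for which its gradient is the
softened field. -/
noncomputable def softPotential (e : ℝ) (b : Space3) (ε : ℝ) (x : Space3) : ℝ :=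
  -(e / (4 * Real.pi)) * (√(‖x - b‖ ^ 2 + ε ^ 2))⁻¹

/-- The Coulomb field softened at the scale `ε`. -/
noncomputable def softField (e : ℝ) (b : Space3) (ε : ℝ) (x : Space3) : Space3 :=
  (e / (4 * Real.pi * √(‖x - b‖ ^ 2 + ε ^ 2) ^ 3)) • (x - b)

theorem softField_zero (x : Space3) : softField e b 0 x = coulombField e b x := by
  simp [softField, coulombField, Real.sqrt_sq (norm_nonneg _)]

theorem hasGradientAt_softPotential {ε : ℝ} {x : Space3} (h : 0 < ‖x - b‖ ^ 2 + ε ^ 2) :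
    HasGradientAt (softPotential e b ε) (softField e b ε x) x := by
  have h1 : HasGradientAt (fun y : Space3 => ‖y - b‖ ^ 2 + ε ^ 2) ((2 : ℝ) • (x - b)) x := by
    have h2 := (hasGradientAt_norm_sq x).add (((hasGradientAt_inner_right b x).const_mul (-2)).add
      (hasGradientAt_const x (‖b‖ ^ 2 + ε ^ 2)))
    convert h2 using 1
    · funext y
      rw [norm_sub_sq_real]
      ring
    · module
  have hs := Real.sqrt_pos.2 h
  have h3 := (((hasDerivAt_inv hs.ne').comp _ (Real.hasDerivAt_sqrt h.ne')).const_mul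
    (-(e / (4 * Real.pi)))).comp_hasGradientAt x h1
  have h4 : HasGradientAt (softPotential e b ε) _ x := h3
  convert h4 using 1
  rw [softField, smul_smul]
  congr 1
  have := Real.pi_pos
  field_simp

theorem contDiff_softPotential {ε : ℝ} (hε : 0 < ε) {n : ℕ∞} :
    ContDiff ℝ n (softPotential e b ε) := by
  have h0 : ∀ x : Space3, 0 < ‖x - b‖ ^ 2 + ε ^ 2 := fun x => by positivity
  have h1 : ContDiff ℝ n fun x : Space3 => ‖x - b‖ ^ 2 + ε ^ 2 :=
    ((contDiff_id.sub contDiff_const).norm_sq ℝ).add contDiff_const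
  exact contDiff_const.mul ((h1.sqrt fun x => (h0 x).ne').inv
    fun x => (Real.sqrt_pos.2 (h0 x)).ne')

theorem gradient_softPotential {ε : ℝ} (hε : 0 < ε) :
    gradient (softPotential e b ε) = softField e b ε :=
  gradient_eq fun x => hasGradientAt_softPotential (by positivity)

theorem continuous_softField {ε : ℝ} (hε : 0 < ε) : Continuous (softField e b ε) := by
  rw [← gradient_softPotential hε]
  exact continuous_gradient (contDiff_softPotential hε)

theorem norm_softField_le (ε : ℝ) (x : Space3) : ‖softField e b ε x‖ ≤ ‖coulombField e b x‖ := by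
  rw [softField, coulombField, norm_smul, norm_smul]
  by_cases h : ‖x - b‖ = 0
  · simp [h]
  have h0 : 0 < ‖x - b‖ := lt_of_le_of_ne (norm_nonneg _) (Ne.symm h)
  have h1 : ‖x - b‖ ≤ √(‖x - b‖ ^ 2 + ε ^ 2) := Real.le_sqrt_of_sq_le (by nlinarith [sq_nonneg ε])
  have := Real.pi_pos
  rw [norm_div, norm_div, Real.norm_of_nonneg (r := 4 * Real.pi * ‖x - b‖ ^ 3) (by positivity),
    Real.norm_of_nonneg (r := 4 * Real.pi * √(‖x - b‖ ^ 2 + ε ^ 2) ^ 3) (by positivity)]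
  gcongr

open Filter in
theorem tendsto_softField (x : Space3) :
    Tendsto (fun n : ℕ => softField e b (1 / ((n : ℝ) + 1)) x) atTop (𝓝 (coulombField e b x)) := by
  by_cases h : x = b
  · simp [softField, coulombField, h]
  have h0 : 0 < ‖x - b‖ := norm_pos_iff.2 (sub_ne_zero.2 h)
  have hc : ContinuousAt (fun ε : ℝ => softField e b ε x) 0 := by
    unfold softField
    have h1 : ContinuousAt (fun ε : ℝ => 4 * Real.pi * √(‖x - b‖ ^ 2 + ε ^ 2) ^ 3) 0 := by fun_prop
    refine ContinuousAt.smul (continuousAt_const.div h1 ?_) continuousAt_const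
    have := Real.pi_pos
    have : 0 < √(‖x - b‖ ^ 2 + 0 ^ 2) := Real.sqrt_pos.2 (by positivity)
    positivity
  have := hc.tendsto.comp tendsto_one_div_add_atTop_nhds_zero_nat
  simpa [softField_zero, Function.comp_def] using this

open Filter in
theorem tendsto_softPotential_cocompact (ε : ℝ) :
    Tendsto (softPotential e b ε) (cocompact Space3) (𝓝 0) := by
  have h1 : Tendsto (fun x : Space3 => ‖x - b‖) (cocompact Space3) atTop := by
    refine tendsto_atTop_mono (fun x => norm_sub_norm_le x b) ?_
    simpa [sub_eq_add_neg] using tendsto_atTop_add_const_right _ (-‖b‖) (tendsto_norm_cocompact_atTop (E := Space3))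
  have h2 : Tendsto (fun x : Space3 => √(‖x - b‖ ^ 2 + ε ^ 2)) (cocompact Space3) atTop :=
    tendsto_atTop_mono (fun x => Real.le_sqrt_of_sq_le (by nlinarith [sq_nonneg ε])) h1
  have h3 := (tendsto_inv_atTop_zero.comp h2).const_mul (-(e / (4 * Real.pi)))
  rwa [mul_zero] at h3

theorem integrableOn_inner_coulombField_compl (ha : a ∈ ball (0 : Space3) R)
    (hb : b ∈ ball (0 : Space3) R) {G : Space3 → Space3} (hG : Measurable G)
    (hGb : ∀ x, ‖G x‖ ≤ ‖coulombField e b x‖) :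
    IntegrableOn (fun x => inner ℝ (coulombField e a x) (G x)) (ball (0 : Space3) R)ᶜ := by
  refine Integrable.mono' (integrableOn_norm_coulombField_mul (e := e) ha hb)
    ((measurable_coulombField e a).inner hG).aestronglyMeasurable (.of_forall fun x => ?_)
  exact (norm_inner_le_norm _ _).trans (by gcongr; exact hGb x)

-- Outside the ball `coulombField e 0` is also the field of the charge spread uniformly over the
-- sphere, whose field inside is zero and whose potential is constant there. Gauss' law for the
-- charge at `a` evaluates that constant, whatever the position of `a`.
open Filter in
theorem integral_compl_ball_inner_coulombField (hR : 0 < R) (ha : a ∈ ball (0 : Space3) R) :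
    ∫ x in (ball (0 : Space3) R)ᶜ, inner ℝ (coulombField e a x) (coulombField e 0 x)
      = e ^ 2 / (4 * Real.pi * R) := by
  set G : Space3 → Space3 := (ball (0 : Space3) R)ᶜ.indicator (coulombField e 0) with hG
  set ψ : Space3 → ℝ := fun x => -(e / (4 * Real.pi)) * (max ‖x‖ R)⁻¹ with hψ
  have hmax : ∀ x : Space3, 0 < max ‖x‖ R := fun x => hR.trans_le (le_max_right _ _)
  have hgrad : ∀ x : Space3, ‖x‖ ≠ R → HasGradientAt ψ (G x) x := by
    intro x hx
    rcases lt_or_gt_of_ne hx with h | h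
    · have hxG : G x = 0 := by simp [hG, h]
      rw [hxG]
      refine (hasGradientAt_const x (-(e / (4 * Real.pi)) * R⁻¹)).congr_of_eventuallyEq ?_
      filter_upwards [continuous_norm.continuousAt.eventually (gt_mem_nhds h)] with y hy
      simp [hψ, max_eq_right (le_of_lt hy)]
    · have hxG : G x = softField e 0 0 x := by
        rw [softField_zero, hG, indicator_of_mem (by simpa using h.le)]
      rw [hxG]
      have h0 := hR.trans h
      refine (hasGradientAt_softPotential (by simpa using pow_pos h0 2)).congr_of_eventuallyEq ?_
      filter_upwards [continuous_norm.continuousAt.eventually (lt_mem_nhds h)] with y hy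
      simp [hψ, softPotential, max_eq_left (le_of_lt hy), Real.sqrt_sq (norm_nonneg y)]
  have hind : (fun x => inner ℝ (coulombField e a x) (G x)) = (ball (0 : Space3) R)ᶜ.indicator
      fun x => inner ℝ (coulombField e a x) (coulombField e 0 x) := by
    funext x
    by_cases hx : x ∈ (ball (0 : Space3) R)ᶜ
    · simp only [hG, indicator_of_mem hx]
    · simp only [hG, indicator_of_notMem hx, inner_zero_right]
  have h := integral_inner_coulombField e a (ψ := ψ) (G := G)
    (continuous_const.mul ((continuous_norm.max continuous_const).inv₀ fun x => (hmax x).ne'))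
    (fun w hw => (countable_setOf_norm_smul_add_eq hw a R).mono fun r hr => by
      by_contra h; exact hr (hgrad _ h)) ?_ ?_
  · rw [hind, integral_indicator measurableSet_ball.compl] at h
    have haR : ‖a‖ < R := by simpa using ha
    have := Real.pi_pos
    rw [h, hψ]
    simp only [max_eq_right haR.le]
    field_simp
  · have h2 : Tendsto (fun x : Space3 => max ‖x‖ R) (cocompact Space3) atTop :=
      tendsto_atTop_mono (fun x => le_max_left _ _) (tendsto_norm_cocompact_atTop (E := Space3))
    have h3 := (tendsto_inv_atTop_zero.comp h2).const_mul (-(e / (4 * Real.pi)))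
    rwa [mul_zero] at h3
  · rw [hind, integrable_indicator_iff measurableSet_ball.compl]
    exact integrableOn_inner_coulombField_compl ha (mem_ball_self hR)
      (measurable_coulombField e 0) fun x => le_rfl

/-- Both `totalField e a (regField R e a)` and `coulombField e 0` have normal component `e/(4πR²)`
on the sphere, so their difference carries no flux through it. -/
theorem integral_ball_inner_zeroFluxField_gradient (hR : 0 < R) (ha : a ∈ ball (0 : Space3) R)
    {ψ : Space3 → ℝ} (hψ : ∀ x ∈ closedBall (0 : Space3) R, ContDiffAt ℝ 1 ψ x) :
    ∫ x in ball (0 : Space3) R, inner ℝ (totalField e a (regField R e a) x - coulombField e 0 x)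
      (gradient ψ x) = -e * (ψ a - ψ 0) := by
  have haR : ‖a‖ < R := by simpa using ha
  have hgc : ContinuousOn (gradient ψ) (closedBall 0 R) := fun x hx =>
    ((InnerProductSpace.toDual ℝ Space3).symm.continuous.continuousAt.comp
      ((hψ x hx).fderiv_right (m := 0) (by norm_num)).continuousAt).continuousWithinAt
  obtain ⟨M, hM⟩ := (isCompact_closedBall (0 : Space3) R).exists_bound_of_continuousOn
    (f := ψ) fun x hx => (hψ x hx).continuousAt.continuousWithinAt
  obtain ⟨M', hM'⟩ := (isCompact_closedBall (0 : Space3) R).exists_bound_of_continuousOn hgc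
  have hint : IntegrableOn (totalField e a (regField R e a)) (ball 0 R) :=
    (integrableOn_coulombField e a R).add (integrableOn_of_continuousOn_closedBall (continuousOn_regField (e := e) ha))
  refine integral_ball_inner_gradient_of_zero_flux (M := max M M') hR ha (mem_ball_self hR)
    (fun χ hχ hc hs => ?_) (hint.sub (integrableOn_coulombField e 0 R)) (fun ε hε => ?_)
    (fun x hx => (hψ x (ball_subset_closedBall hx)).contDiffWithinAt)
    (fun x hx => (hM x (ball_subset_closedBall hx)).trans (le_max_left _ _))
    (fun x hx => (hM' x (ball_subset_closedBall hx)).trans (le_max_right _ _))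
  · change ∫ x in ball (0 : Space3) R, inner ℝ (totalField e a (regField R e a) x
      - coulombField e 0 x) (gradient χ x) = _
    simp only [inner_sub_left]
    rw [integral_sub (integrableOn_ball_inner_gradient hint hχ hc)
      (integrableOn_ball_inner_gradient (integrableOn_coulombField e 0 R) hχ hc),
      integral_ball_inner_totalField_gradient (continuousOn_regField ha) (contDiffOn_regField ha)
        (fun x hx => divergence_regField hR ha (ball_subset_closedBall hx)) hχ hc hs,
      integral_ball_inner_coulombField_gradient hχ hc hs]
    ring
  -- A shell that contains neither `a` nor `0`, so the field is continuous on it.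
  · refine exists_radius_abs_le_of_eq_zero_on_sphere (r₀ := (‖a‖ + R) / 2) (by linarith)
      (G := fun x => inner ℝ (totalField e a (regField R e a) x - coulombField e 0 x) x)
      (fun x hx => ?_) (fun x hx => ?_) hε
    · have hxa : x ≠ a := by rintro rfl; linarith [hx.1]
      have hx0 : x ≠ 0 := by rintro rfl; linarith [hx.1, norm_nonneg a, (norm_zero (E := Space3))]
      exact ((((continuousAt_coulombField hxa).add (contDiffAt_regField ha (n := 0)
        (by simpa using hx.2)).continuousAt).sub (continuousAt_coulombField hx0)).inner
          continuousAt_id).continuousWithinAt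
    · have hxR : ‖x‖ = R := by simpa using hx
      have := Real.pi_pos
      rw [inner_sub_left, totalField, inner_regField_sphere hR ha hx, coulombField, sub_zero,
        real_inner_smul_left, real_inner_self_eq_norm_sq, hxR]
      field_simp
      ring

-- Take a potential `V` with gradient `C_b`, the Coulomb field at `b`. Testing the zero-flux field
-- with `V` gives `-e (V a - V 0)` over the ball, and Gauss' law gives `-e V a` and `-e V 0` for the
-- Coulomb fields at `a` and `0` over the whole space. Subtracting leaves the exterior integrals.
-- Since `V` is singular at `b`, this is done for the softened potential, and the limit is taken by
-- dominated convergence.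
open Filter in
theorem integral_ball_inner_regField_coulombField (hR : 0 < R) (ha : a ∈ ball (0 : Space3) R)
    (hb : b ∈ ball (0 : Space3) R) :
    ∫ x in ball (0 : Space3) R, inner ℝ (regField R e a x) (coulombField e b x)
      = (∫ x in (ball (0 : Space3) R)ᶜ, inner ℝ (coulombField e a x) (coulombField e b x))
        - ∫ x in (ball (0 : Space3) R)ᶜ, inner ℝ (coulombField e 0 x) (coulombField e b x) := by
  have h0 : (0 : Space3) ∈ ball (0 : Space3) R := mem_ball_self hR
  have hmeas : ∀ {ε : ℝ}, 0 < ε → Measurable (softField e b ε) := fun hε =>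
    (continuous_softField hε).measurable
  have hball : ∀ {ε : ℝ} {F : Space3 → Space3}, 0 < ε → IntegrableOn F (ball 0 R) →
      IntegrableOn (fun x => inner ℝ (F x) (softField e b ε x)) (ball 0 R) := by
    intro ε F hε hF
    obtain ⟨M, hM⟩ := (isCompact_closedBall (0 : Space3) R).exists_bound_of_continuousOn
      (continuous_softField (e := e) (b := b) hε).continuousOn
    exact IntegrableOn.inner_of_bounded measurableSet_ball hF
      (continuous_softField hε).continuousOn fun x hx => hM x (ball_subset_closedBall hx)
  have hsoft : ∀ {c : Space3} {ε : ℝ}, c ∈ ball (0 : Space3) R → 0 < ε →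
      (∫ x in ball (0 : Space3) R, inner ℝ (coulombField e c x) (softField e b ε x))
        + ∫ x in (ball (0 : Space3) R)ᶜ, inner ℝ (coulombField e c x) (softField e b ε x)
        = -(e * softPotential e b ε c) := by
    intro c ε hc hε
    have h1 := hball hε (integrableOn_coulombField e c R)
    have h2 := integrableOn_inner_coulombField_compl (e := e) hc hb (hmeas hε) (norm_softField_le ε)
    have hi : Integrable fun x => inner ℝ (coulombField e c x) (softField e b ε x) := by
      rw [← integrableOn_univ, ← union_compl_self (ball (0 : Space3) R)]
      exact h1.union h2
    rw [integral_add_compl measurableSet_ball hi]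
    refine integral_inner_coulombField e c (contDiff_softPotential hε (n := 0)).continuous
      (fun w _ => ?_) (tendsto_softPotential_cocompact ε) hi
    have hall : ∀ x, HasGradientAt (softPotential e b ε) (softField e b ε x) x := fun x =>
      hasGradientAt_softPotential (by positivity)
    simp [hall]
  have hreg := integrableOn_of_continuousOn_closedBall (continuousOn_regField (e := e) ha)
  have heq : ∀ {ε : ℝ}, 0 < ε →
      ∫ x in ball (0 : Space3) R, inner ℝ (regField R e a x) (softField e b ε x)
      = (∫ x in (ball (0 : Space3) R)ᶜ, inner ℝ (coulombField e a x) (softField e b ε x))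
        - ∫ x in (ball (0 : Space3) R)ᶜ, inner ℝ (coulombField e 0 x) (softField e b ε x) := by
    intro ε hε
    have h1 := integral_ball_inner_zeroFluxField_gradient (e := e) hR ha
      (ψ := softPotential e b ε) fun x _ => (contDiff_softPotential hε (n := 1)).contDiffAt
    rw [gradient_softPotential hε] at h1
    simp only [totalField, inner_sub_left, inner_add_left] at h1
    have hadd : IntegrableOn (fun x => inner ℝ (coulombField e a x) (softField e b ε x)
        + inner ℝ (regField R e a x) (softField e b ε x)) (ball 0 R) :=
      (hball hε (integrableOn_coulombField e a R)).add (hball hε hreg)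
    rw [integral_sub hadd
      (hball hε (integrableOn_coulombField e 0 R)),
      integral_add (hball hε (integrableOn_coulombField e a R)) (hball hε hreg)] at h1
    linarith [hsoft ha hε, hsoft h0 hε]
  have hpos : ∀ n : ℕ, (0 : ℝ) < 1 / ((n : ℝ) + 1) := fun n => by positivity
  have hlim : ∀ {c : Space3}, c ∈ ball (0 : Space3) R → Tendsto (fun n : ℕ =>
      ∫ x in (ball (0 : Space3) R)ᶜ,
        inner ℝ (coulombField e c x) (softField e b (1 / ((n : ℝ) + 1)) x)) atTop
      (𝓝 (∫ x in (ball (0 : Space3) R)ᶜ, inner ℝ (coulombField e c x) (coulombField e b x))) := by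
    intro c hc
    refine tendsto_integral_of_dominated_convergence
      (fun x => ‖coulombField e c x‖ * ‖coulombField e b x‖)
      (fun n => (integrableOn_inner_coulombField_compl hc hb (hmeas (hpos n))
        (norm_softField_le _)).aestronglyMeasurable)
      (integrableOn_norm_coulombField_mul hc hb) (fun n => .of_forall fun x => ?_)
      (.of_forall fun x => tendsto_const_nhds.inner (tendsto_softField x))
    exact (norm_inner_le_norm _ _).trans (by gcongr; exact norm_softField_le _ _)
  have hlim' : Tendsto (fun n : ℕ => ∫ x in ball (0 : Space3) R,
        inner ℝ (regField R e a x) (softField e b (1 / ((n : ℝ) + 1)) x)) atTop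
      (𝓝 (∫ x in ball (0 : Space3) R, inner ℝ (regField R e a x) (coulombField e b x))) := by
    obtain ⟨M, hM⟩ := (isCompact_closedBall (0 : Space3) R).exists_bound_of_continuousOn
      (continuousOn_regField (e := e) ha)
    refine tendsto_integral_of_dominated_convergence (fun x => M * ‖coulombField e b x‖)
      (fun n => (hball (hpos n) hreg).aestronglyMeasurable)
      ((integrableOn_coulombField e b R).norm.const_mul M) (fun n => ?_)
      (.of_forall fun x => tendsto_const_nhds.inner (tendsto_softField x))
    filter_upwards [ae_restrict_mem measurableSet_ball] with x hx
    have h1 := hM x (ball_subset_closedBall hx)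
    exact (norm_inner_le_norm _ _).trans
      (mul_le_mul h1 (norm_softField_le _ _) (norm_nonneg _) ((norm_nonneg _).trans h1))
  refine tendsto_nhds_unique hlim' ?_
  simpa only [heq (hpos _)] using (hlim ha).sub (hlim h0)

end

/-! ### The renormalized energy in closed form. -/

section

variable {R e : ℝ} {a : Space3}

theorem integrableOn_ball_inner_of_continuousOn_closedBall {F G : Space3 → Space3}
    (hF : IntegrableOn F (ball 0 R)) (hG : ContinuousOn G (closedBall 0 R)) :
    IntegrableOn (fun x => inner ℝ (F x) (G x)) (ball 0 R) := by
  obtain ⟨M, hM⟩ := (isCompact_closedBall (0 : Space3) R).exists_bound_of_continuousOn hG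
  exact IntegrableOn.inner_of_bounded measurableSet_ball hF (hG.mono ball_subset_closedBall)
    fun x hx => hM x (ball_subset_closedBall hx)

theorem energyConverges_of_continuousOn (ha : a ∈ ball (0 : Space3) R) {D : Space3 → Space3}
    (hD : ContinuousOn D (closedBall 0 R)) : EnergyConverges R e a D := by
  refine ⟨?_, ((hD.norm.pow 2).integrableOn_compact (isCompact_closedBall _ _)).mono_set
    ball_subset_closedBall,
    integrableOn_ball_inner_of_continuousOn_closedBall (integrableOn_coulombField e a R) hD⟩
  simpa only [sq] using integrableOn_norm_coulombField_mul (e := e) ha ha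

theorem imageDist_self (ha : a ∈ ball (0 : Space3) R) : imageDist R a a = R ^ 2 - ‖a‖ ^ 2 := by
  have haR : ‖a‖ < R := by simpa using ha
  rw [imageDist, real_inner_self_eq_norm_sq, Real.sqrt_eq_iff_mul_self_eq_of_pos]
  · ring
  · nlinarith [norm_nonneg a]

theorem regPotential_self_sub_zero (hR : 0 < R) (ha : a ∈ ball (0 : Space3) R) :
    regPotential R e a a - regPotential R e a 0 = e / (4 * Real.pi)
      * (R / (R ^ 2 - ‖a‖ ^ 2) - 1 / R * Real.log (1 - ‖a‖ ^ 2 / R ^ 2) - 1 / R) := by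
  have haR : ‖a‖ < R := by simpa using ha
  have h1 : 0 < R ^ 2 - ‖a‖ ^ 2 := by nlinarith [norm_nonneg a]
  have h0 : imageDist R a 0 = R ^ 2 := by
    rw [imageDist, Real.sqrt_eq_iff_mul_self_eq_of_pos (by positivity)]
    simp
    ring
  have h2 : 1 - ‖a‖ ^ 2 / R ^ 2 = (2 * (R ^ 2 - ‖a‖ ^ 2)) / (2 * R ^ 2) := by field_simp
  rw [h2, Real.log_div (by positivity) (by positivity)]
  rw [regPotential, regPotential, imageLog, imageLog, imageDist_self ha, h0, inner_zero_left,
    real_inner_self_eq_norm_sq, sub_zero, ← two_mul, ← two_mul]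
  field_simp
  ring

theorem integral_ball_inner_coulombField_zero_const (E : Space3) :
    ∫ x in ball (0 : Space3) R, inner ℝ (coulombField e 0 x) E = 0 := by
  have h := integral_neg_eq_self
    ((ball (0 : Space3) R).indicator fun x => inner ℝ (coulombField e 0 x) E) volume
  have h2 : ∀ x : Space3, (ball (0 : Space3) R).indicator (fun x => inner ℝ (coulombField e 0 x) E)
      (-x) = -(ball (0 : Space3) R).indicator (fun x => inner ℝ (coulombField e 0 x) E) x := by
    intro x
    simp [indicator, coulombField, inner_smul_left]
    split_ifs <;> simp
  simp only [h2, integral_neg] at h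
  rw [integral_indicator measurableSet_ball] at h
  linarith

theorem renormalizedEnergy_regField (m : ℝ) (hR : 0 < R) (ha : a ∈ ball (0 : Space3) R)
    (E : Space3) :
    renormalizedEnergy m R e a (fun x => regField R e a x + E)
      = m + 1 / 2 * (e ^ 2 / (4 * Real.pi)
          * (R / (R ^ 2 - ‖a‖ ^ 2) - 1 / R * Real.log (1 - ‖a‖ ^ 2 / R ^ 2) - 2 / R)
        + 4 / 3 * Real.pi * R ^ 3 * ‖E‖ ^ 2 - 2 * e * inner ℝ a E) := by
  have h0 : (0 : Space3) ∈ ball (0 : Space3) R := mem_ball_self hR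
  have hregc := continuousOn_regField (e := e) ha
  have hreg := integrableOn_of_continuousOn_closedBall hregc
  have hEc : ContinuousOn (fun _ : Space3 => E) (closedBall 0 R) := continuousOn_const
  have i1 := integrableOn_ball_inner_of_continuousOn_closedBall hreg hregc
  have i2 := integrableOn_ball_inner_of_continuousOn_closedBall hreg hEc
  have i3 := integrableOn_ball_inner_of_continuousOn_closedBall
    (integrableOn_coulombField e a R) hregc
  have i4 := integrableOn_ball_inner_of_continuousOn_closedBall
    (integrableOn_coulombField e a R) hEc
  have i7 : IntegrableOn (fun _ : Space3 => ‖E‖ ^ 2) (ball (0 : Space3) R) :=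
    integrableOn_const measure_ball_lt_top.ne
  have hF : ∀ G : Space3 → Space3, ContinuousOn G (closedBall 0 R) →
      ∫ x in ball (0 : Space3) R,
        inner ℝ (totalField e a (regField R e a) x - coulombField e 0 x) (G x)
      = (∫ x in ball (0 : Space3) R, inner ℝ (coulombField e a x) (G x))
        + (∫ x in ball (0 : Space3) R, inner ℝ (regField R e a x) (G x))
        - ∫ x in ball (0 : Space3) R, inner ℝ (coulombField e 0 x) (G x) := by
    intro G hG
    have j1 := integrableOn_ball_inner_of_continuousOn_closedBall
      (integrableOn_coulombField e a R) hG
    have j2 := integrableOn_ball_inner_of_continuousOn_closedBall hreg hG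
    have j3 := integrableOn_ball_inner_of_continuousOn_closedBall
      (integrableOn_coulombField e 0 R) hG
    have j4 : IntegrableOn (fun x => inner ℝ (coulombField e a x) (G x)
        + inner ℝ (regField R e a x) (G x)) (ball 0 R) := j1.add j2
    rw [← integral_add j1 j2, ← integral_sub j4 j3]
    simp only [totalField, inner_sub_left, inner_add_left]
  -- The zero-flux field tested with `regPotential`, whose gradient is `-regField`.
  have e1 : (∫ x in ball (0 : Space3) R, inner ℝ (coulombField e a x) (regField R e a x))
        + (∫ x in ball (0 : Space3) R, inner ℝ (regField R e a x) (regField R e a x))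
        - (∫ x in ball (0 : Space3) R, inner ℝ (coulombField e 0 x) (regField R e a x))
      = e * (regPotential R e a a - regPotential R e a 0) := by
    rw [← hF _ hregc]
    have h := integral_ball_inner_zeroFluxField_gradient (e := e) hR ha
      (ψ := regPotential R e a) fun x hx => contDiffAt_regPotential ha hx (n := 1)
    have h2 : ∫ x in ball (0 : Space3) R,
        inner ℝ (totalField e a (regField R e a) x - coulombField e 0 x) (regField R e a x)
        = ∫ x in ball (0 : Space3) R, -inner ℝ (totalField e a (regField R e a) x
          - coulombField e 0 x) (gradient (regPotential R e a) x) := by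
      refine setIntegral_congr_fun measurableSet_ball fun x hx => ?_
      simp only [(hasGradientAt_regPotential (e := e) ha (ball_subset_closedBall hx)).gradient,
        inner_neg_right, neg_neg]
    rw [h2, integral_neg, h]
    ring
  -- The zero-flux field tested with a linear function; the contribution of the central charge
  -- vanishes by oddness.
  have e2 : (∫ x in ball (0 : Space3) R, inner ℝ (coulombField e a x) E)
        + (∫ x in ball (0 : Space3) R, inner ℝ (regField R e a x) E) = -e * inner ℝ a E := by
    have h := integral_ball_inner_zeroFluxField_gradient (e := e) hR ha
      (ψ := fun x => inner ℝ x E) fun x hx => contDiffAt_id.inner ℝ contDiffAt_const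
    rw [gradient_eq (hasGradientAt_inner_right E), hF _ hEc,
      integral_ball_inner_coulombField_zero_const, inner_zero_left, sub_zero, sub_zero] at h
    exact h
  have hswap : ∀ (F G : Space3 → Space3) (s : Set Space3),
      ∫ x in s, inner ℝ (F x) (G x) = ∫ x in s, inner ℝ (G x) (F x) := fun F G s =>
    integral_congr_ae (.of_forall fun x => real_inner_comm _ _)
  -- With `b = 0` both exterior integrals equal `e²/(4πR)`, so `regField` is orthogonal to the
  -- central Coulomb field.
  have e3 := integral_ball_inner_regField_coulombField (e := e) hR ha h0
  rw [integral_compl_ball_inner_coulombField hR ha, integral_compl_ball_inner_coulombField hR h0,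
    sub_self, hswap] at e3
  have e4 := integral_ball_inner_regField_coulombField (e := e) hR ha ha
  rw [hswap, hswap (coulombField e 0), integral_compl_ball_inner_coulombField hR ha] at e4
  simp only [real_inner_self_eq_norm_sq] at e4 e1
  rw [e3, regPotential_self_sub_zero hR ha] at e1
  have e6 : ∫ x in ball (0 : Space3) R, ‖regField R e a x + E‖ ^ 2
      = (∫ x in ball (0 : Space3) R, ‖regField R e a x‖ ^ 2)
        + 2 * (∫ x in ball (0 : Space3) R, inner ℝ (regField R e a x) E)
        + 4 / 3 * Real.pi * R ^ 3 * ‖E‖ ^ 2 := by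
    simp only [real_inner_self_eq_norm_sq] at i1
    have hc : ∫ x in ball (0 : Space3) R, ‖E‖ ^ 2 = 4 / 3 * Real.pi * R ^ 3 * ‖E‖ ^ 2 := by
      rw [setIntegral_const, volume_real_ball_space3 _ hR.le, smul_eq_mul]
    have j : IntegrableOn (fun x => ‖regField R e a x‖ ^ 2 + 2 * inner ℝ (regField R e a x) E)
        (ball 0 R) := i1.add (i2.const_mul 2)
    rw [← hc, ← integral_const_mul, ← integral_add i1 (i2.const_mul 2), ← integral_add j i7]
    simp only [norm_add_sq_real]
  have e7 : ∫ x in ball (0 : Space3) R, inner ℝ (coulombField e a x) (regField R e a x + E)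
      = (∫ x in ball (0 : Space3) R, inner ℝ (coulombField e a x) (regField R e a x))
        + ∫ x in ball (0 : Space3) R, inner ℝ (coulombField e a x) E := by
    rw [← integral_add i3 i4]
    simp only [inner_add_right]
  rw [renormalizedEnergy, e6, e7]
  have hpi := Real.pi_pos
  have e8 : e ^ 2 / (4 * Real.pi * R) = e ^ 2 / (4 * Real.pi) * (1 / R) := by field_simp
  rw [e8] at e4
  have e9 : (2 : ℝ) / R = 1 / R + 1 / R := by ring
  rw [e9]
  -- Half of the interaction integral comes from `e1`, together with the self-energy of `regField`.
  -- The other half comes from `e4`, together with the exterior energy, which thereby cancels. Each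
  -- of the two supplies one of the terms `1/R` in `2/R`.
  linear_combination (1 / 2 : ℝ) * e1 + (1 / 2 : ℝ) * e4 + e2

theorem IsNeumannSolution.renormalizedEnergy_eq (m : ℝ) (hR : 0 < R)
    (ha : a ∈ ball (0 : Space3) R) {E : Space3} {φ : Space3 → ℝ} {D : Space3 → Space3}
    (h : IsNeumannSolution R e a E φ D) :
    renormalizedEnergy m R e a D
      = m + 1 / 2 * (e ^ 2 / (4 * Real.pi)
          * (R / (R ^ 2 - ‖a‖ ^ 2) - 1 / R * Real.log (1 - ‖a‖ ^ 2 / R ^ 2) - 2 / R)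
        + 4 / 3 * Real.pi * R ^ 3 * ‖E‖ ^ 2 - 2 * e * inner ℝ a E) := by
  rw [← renormalizedEnergy_regField m hR ha E]
  have heq := h.eqOn hR (isNeumannSolution_regField hR ha E)
  have h1 : ∫ x in ball (0 : Space3) R, ‖D x‖ ^ 2
      = ∫ x in ball (0 : Space3) R, ‖regField R e a x + E‖ ^ 2 :=
    setIntegral_congr_fun measurableSet_ball fun x hx => by
      simp only [heq (ball_subset_closedBall hx)]
  have h2 : ∫ x in ball (0 : Space3) R, inner ℝ (coulombField e a x) (D x)
      = ∫ x in ball (0 : Space3) R, inner ℝ (coulombField e a x) (regField R e a x + E) :=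
    setIntegral_congr_fun measurableSet_ball fun x hx => by
      simp only [heq (ball_subset_closedBall hx)]
  rw [renormalizedEnergy, renormalizedEnergy, h1, h2]

theorem regField_self (hR : 0 < R) (ha : a ∈ ball (0 : Space3) R) :
    regField R e a a = -((e / (4 * Real.pi)
      * ((2 * R ^ 2 - ‖a‖ ^ 2) / (R * (R ^ 2 - ‖a‖ ^ 2) ^ 2))) • a) := by
  have haR : ‖a‖ < R := by simpa using ha
  have h1 : 0 < R ^ 2 - ‖a‖ ^ 2 := by nlinarith [norm_nonneg a]
  have hv : imageVec R a a = (-(R ^ 2 - ‖a‖ ^ 2)) • a := by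
    rw [imageVec, ← sub_smul, neg_sub]
  have hw : (R ^ 2 - ‖a‖ ^ 2)⁻¹ • (-(R ^ 2 - ‖a‖ ^ 2)) • a - a = (-2 : ℝ) • a := by
    rw [smul_smul, mul_neg, inv_mul_cancel₀ h1.ne']
    module
  rw [regField, imageLog, imageDist_self ha, hv, hw, real_inner_self_eq_norm_sq, smul_smul,
    smul_smul, ← add_smul, smul_smul, ← neg_smul]
  congr 1
  field_simp
  ring

end

/-! ### One-variable analysis of the standardized energy. -/

/-- The value of `q` for which `x` is the equilibrium position. -/
noncomputable def equilibriumCharge (x : ℝ) : ℝ := x * (2 - x ^ 2) / (1 - x ^ 2) ^ 2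

theorem one_sub_sq_pos_of_mem_Ioo {x : ℝ} (hx : x ∈ Ioo (-1 : ℝ) 1) : 0 < 1 - x ^ 2 := by
  nlinarith [hx.1, hx.2]

theorem hasDerivAt_equilibriumCharge {x : ℝ} (hx : x ∈ Ioo (-1 : ℝ) 1) :
    HasDerivAt equilibriumCharge ((2 + 3 * x ^ 2 - x ^ 4) / (1 - x ^ 2) ^ 3) x := by
  have h := one_sub_sq_pos_of_mem_Ioo hx
  have h1 : HasDerivAt (fun y : ℝ => y ^ 2) (2 * x) x := by simpa using hasDerivAt_pow 2 x
  have h2 := ((hasDerivAt_id x).mul (h1.const_sub 2)).div ((h1.const_sub 1).pow 2)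
    (pow_ne_zero 2 h.ne')
  refine h2.congr_deriv ?_
  simp only [id, Pi.mul_apply, Pi.pow_apply]
  field_simp
  ring

theorem deriv_equilibriumCharge_pos {x : ℝ} (hx : x ∈ Ioo (-1 : ℝ) 1) :
    0 < (2 + 3 * x ^ 2 - x ^ 4) / (1 - x ^ 2) ^ 3 := by
  have h := one_sub_sq_pos_of_mem_Ioo hx
  refine div_pos ?_ (by positivity)
  nlinarith [sq_nonneg x]

theorem strictMonoOn_equilibriumCharge : StrictMonoOn equilibriumCharge (Ioo (-1) 1) := by
  refine strictMonoOn_of_deriv_pos (convex_Ioo _ _)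
    (fun x hx => (hasDerivAt_equilibriumCharge hx).continuousAt.continuousWithinAt) fun x hx => ?_
  rw [interior_Ioo] at hx
  rw [(hasDerivAt_equilibriumCharge hx).deriv]
  exact deriv_equilibriumCharge_pos hx

theorem equilibriumCharge_neg (x : ℝ) : equilibriumCharge (-x) = -equilibriumCharge x := by
  simp only [equilibriumCharge, neg_sq]
  ring

theorem exists_equilibriumCharge_eq (q : ℝ) : ∃ x ∈ Ioo (-1 : ℝ) 1, equilibriumCharge x = q := by
  -- At `1 - d` the numerator is at least `1/2` and the denominator at most `(2d)² = (|q| + 1)⁻²`.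
  -- Hence the value is at least `(|q| + 1)²/2 ≥ |q|`, and oddness with the intermediate value
  -- theorem does the rest.
  set d := 1 / (2 * (|q| + 1)) with hd
  have hq := abs_nonneg q
  have hd0 : 0 < d := by positivity
  have hd1 : 2 * d * (|q| + 1) = 1 := by rw [hd]; field_simp
  have hd2 : d ≤ 1 / 2 := by nlinarith
  have hy : (1 - d) ∈ Ioo (-1 : ℝ) 1 := ⟨by linarith, by linarith⟩
  have hy' : -(1 - d) ∈ Ioo (-1 : ℝ) 1 := ⟨by linarith, by linarith⟩
  have hpos := one_sub_sq_pos_of_mem_Ioo hy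
  have hle : 1 - (1 - d) ^ 2 ≤ 2 * d := by nlinarith
  have hbig : |q| ≤ equilibriumCharge (1 - d) := by
    rw [equilibriumCharge, le_div_iff₀ (by positivity)]
    have h1 : (1 - (1 - d) ^ 2) ^ 2 ≤ (2 * d) ^ 2 := by gcongr
    have h2 : |q| * (2 * d) ^ 2 ≤ 1 / 2 := by
      have : 2 * |q| * (2 * d) ^ 2 ≤ (2 * d * (|q| + 1)) ^ 2 := by
        nlinarith [mul_nonneg (sq_nonneg (2 * d)) (by nlinarith [sq_nonneg (|q|)] : (0:ℝ) ≤ (|q| + 1) ^ 2 - 2 * |q|)]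
      rw [hd1] at this
      linarith
    have h3 : |q| * (1 - (1 - d) ^ 2) ^ 2 ≤ |q| * (2 * d) ^ 2 := by gcongr
    have h4 : (1 : ℝ) / 2 ≤ (1 - d) * (2 - (1 - d) ^ 2) := by nlinarith
    linarith
  have hsub : Icc (-(1 - d)) (1 - d) ⊆ Ioo (-1 : ℝ) 1 := fun x hx =>
    ⟨hy'.1.trans_le hx.1, hx.2.trans_lt hy.2⟩
  obtain ⟨x, hx, hxq⟩ := intermediate_value_Icc (by linarith : -(1 - d) ≤ 1 - d)
    (fun x hx => (hasDerivAt_equilibriumCharge (hsub hx)).continuousAt.continuousWithinAt)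
    ⟨by rw [equilibriumCharge_neg]; linarith [neg_abs_le q], (le_abs_self q).trans hbig⟩
  exact ⟨x, hsub hx, hxq⟩

/-- The position in the unit interval minimizing the standardized energy. -/
noncomputable def equilibriumPosition (q : ℝ) : ℝ := (exists_equilibriumCharge_eq q).choose

theorem equilibriumPosition_mem (q : ℝ) : equilibriumPosition q ∈ Ioo (-1 : ℝ) 1 :=
  (exists_equilibriumCharge_eq q).choose_spec.1

theorem equilibriumCharge_equilibriumPosition (q : ℝ) :
    equilibriumCharge (equilibriumPosition q) = q :=
  (exists_equilibriumCharge_eq q).choose_spec.2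

theorem eq_equilibriumPosition_iff {x q : ℝ} (hx : x ∈ Ioo (-1 : ℝ) 1) :
    q = equilibriumCharge x ↔ x = equilibriumPosition q := by
  conv_lhs => rw [← equilibriumCharge_equilibriumPosition q]
  rw [strictMonoOn_equilibriumCharge.eq_iff_eq (equilibriumPosition_mem q) hx, eq_comm]

theorem strictMono_equilibriumPosition : StrictMono equilibriumPosition := fun q₁ q₂ h => by
  rwa [← strictMonoOn_equilibriumCharge.lt_iff_lt (equilibriumPosition_mem _)
    (equilibriumPosition_mem _), equilibriumCharge_equilibriumPosition,
    equilibriumCharge_equilibriumPosition]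

theorem equilibriumPosition_zero : equilibriumPosition 0 = 0 :=
  ((eq_equilibriumPosition_iff (x := 0) (by simp)).1 (by simp [equilibriumCharge])).symm

theorem hasDerivAt_stdEnergy {x : ℝ} (q : ℝ) (hx : x ∈ Ioo (-1 : ℝ) 1) :
    HasDerivAt (fun y => stdEnergy y q) (2 * (equilibriumCharge x - q)) x := by
  have h := one_sub_sq_pos_of_mem_Ioo hx
  have h1 : HasDerivAt (fun y : ℝ => 1 - y ^ 2) (-(2 * x)) x := by
    simpa using (hasDerivAt_pow 2 x).const_sub 1
  have h2 := (((((hasDerivAt_const x (1 : ℝ)).fun_div h1 h.ne').sub (h1.log h.ne')).sub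
    ((hasDerivAt_id x).const_mul (2 * q))).add_const (q ^ 2 / 3)).sub_const 2
  refine h2.congr_deriv ?_
  rw [equilibriumCharge]
  field_simp
  ring

theorem strictAntiOn_stdEnergy (q : ℝ) :
    StrictAntiOn (fun y => stdEnergy y q) (Ioc (-1) (equilibriumPosition q)) := by
  have hsub : Ioc (-1) (equilibriumPosition q) ⊆ Ioo (-1 : ℝ) 1 := fun x hx =>
    ⟨hx.1, hx.2.trans_lt (equilibriumPosition_mem q).2⟩
  refine strictAntiOn_of_deriv_neg (convex_Ioc _ _)
    (fun x hx => (hasDerivAt_stdEnergy q (hsub hx)).continuousAt.continuousWithinAt) fun x hx => ?_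
  rw [interior_Ioc] at hx
  have hx' := hsub (Ioo_subset_Ioc_self hx)
  rw [(hasDerivAt_stdEnergy q hx').deriv]
  have := strictMonoOn_equilibriumCharge hx' (equilibriumPosition_mem q) hx.2
  rw [equilibriumCharge_equilibriumPosition] at this
  linarith

theorem strictMonoOn_stdEnergy (q : ℝ) :
    StrictMonoOn (fun y => stdEnergy y q) (Ico (equilibriumPosition q) 1) := by
  have hsub : Ico (equilibriumPosition q) 1 ⊆ Ioo (-1 : ℝ) 1 := fun x hx =>
    ⟨(equilibriumPosition_mem q).1.trans_le hx.1, hx.2⟩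
  refine strictMonoOn_of_deriv_pos (convex_Ico _ _)
    (fun x hx => (hasDerivAt_stdEnergy q (hsub hx)).continuousAt.continuousWithinAt) fun x hx => ?_
  rw [interior_Ico] at hx
  have hx' := hsub (Ioo_subset_Ico_self hx)
  rw [(hasDerivAt_stdEnergy q hx').deriv]
  have := strictMonoOn_equilibriumCharge (equilibriumPosition_mem q) hx' hx.1
  rw [equilibriumCharge_equilibriumPosition] at this
  linarith

theorem stdEnergy_equilibriumPosition_lt {x q : ℝ} (hx : x ∈ Ioo (-1 : ℝ) 1)
    (hne : x ≠ equilibriumPosition q) : stdEnergy (equilibriumPosition q) q < stdEnergy x q := by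
  have hX := equilibriumPosition_mem q
  rcases lt_or_gt_of_ne hne with h | h
  · exact strictAntiOn_stdEnergy q ⟨hx.1, h.le⟩ ⟨hX.1, le_rfl⟩ h
  · exact strictMonoOn_stdEnergy q ⟨le_rfl, hX.2⟩ ⟨h.le, hx.2⟩ h

/-- With `s = x²`, both `1/(1-s)` and `-log(1-s)` are expanded to first order in `s`; each remainder
is at most `s²/(1-s) ≤ 2s²`. -/
theorem abs_stdEnergy_sub_le {x : ℝ} (q : ℝ) (hx : |x| ≤ 1 / 2) :
    |stdEnergy x q - (-1 + q ^ 2 / 3 - 2 * q * x + 2 * x ^ 2)| ≤ 4 * x ^ 4 := by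
  have hs : x ^ 2 ≤ 1 / 4 := by
    rw [← sq_abs]; nlinarith [abs_nonneg x]
  have hs0 := sq_nonneg x
  have h1 : (1 : ℝ) / 2 ≤ 1 - x ^ 2 := by linarith
  have hlog := Real.abs_log_sub_add_sum_range_le (x := x ^ 2) (by rw [abs_of_nonneg hs0]; linarith) 1
  simp only [Finset.sum_range_one, abs_of_nonneg hs0] at hlog
  norm_num at hlog
  have h2 : (x ^ 2) ^ 2 / (1 - x ^ 2) ≤ 2 * x ^ 4 := by
    rw [div_le_iff₀ (by linarith)]
    nlinarith [sq_nonneg (x ^ 2)]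
  have h3 : (0 : ℝ) ≤ (x ^ 2) ^ 2 / (1 - x ^ 2) := by positivity
  have h4 : stdEnergy x q - (-1 + q ^ 2 / 3 - 2 * q * x + 2 * x ^ 2)
      = (x ^ 2) ^ 2 / (1 - x ^ 2) - (x ^ 2 + Real.log (1 - x ^ 2)) := by
    rw [stdEnergy]
    field_simp
    ring
  rw [h4]
  have h5 := abs_le.1 hlog
  rw [abs_le]
  constructor <;> linarith [h5.1, h5.2]

/-- The quotient `equilibriumCharge x / x = (2 - x²)/(1 - x²)²` is at least its limit `2` at the
origin. -/
theorem two_mul_abs_equilibriumPosition_le (q : ℝ) : 2 * |equilibriumPosition q| ≤ |q| := by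
  have hX := one_sub_sq_pos_of_mem_Ioo (equilibriumPosition_mem q)
  conv_rhs => rw [← equilibriumCharge_equilibriumPosition q]
  set x := equilibriumPosition q
  have hs := sq_nonneg x
  rw [equilibriumCharge, abs_div, abs_mul, abs_of_pos (a := 2 - x ^ 2) (by linarith),
    abs_of_pos (a := (1 - x ^ 2) ^ 2) (by positivity), le_div_iff₀ (by positivity), mul_comm 2,
    mul_assoc]
  refine mul_le_mul_of_nonneg_left ?_ (abs_nonneg x)
  nlinarith

theorem abs_equilibriumPosition_sub_le {q : ℝ} (hq : |q| ≤ 1) :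
    |equilibriumPosition q - q / 2| ≤ |q| ^ 3 := by
  have hX := two_mul_abs_equilibriumPosition_le q
  have h1 := equilibriumCharge_equilibriumPosition q
  have hpos := one_sub_sq_pos_of_mem_Ioo (equilibriumPosition_mem q)
  set x := equilibriumPosition q
  have hs : x ^ 2 ≤ 1 / 4 := by
    rw [← sq_abs]; nlinarith [abs_nonneg x]
  have hs0 := sq_nonneg x
  have h2 : x - q / 2 = -(x ^ 3 * ((3 - 2 * x ^ 2) / (2 * (1 - x ^ 2) ^ 2))) := by
    rw [← h1, equilibriumCharge]
    field_simp
    ring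
  -- A generous bound, chosen because `8 |x|³ = (2|x|)³ ≤ |q|³`.
  have h3 : (3 - 2 * x ^ 2) / (2 * (1 - x ^ 2) ^ 2) ≤ 8 := by
    rw [div_le_iff₀ (by positivity)]
    nlinarith
  have h4 : 0 ≤ (3 - 2 * x ^ 2) / (2 * (1 - x ^ 2) ^ 2) := div_nonneg (by linarith) (by positivity)
  rw [h2, abs_neg, abs_mul, abs_of_nonneg h4, abs_pow]
  have h5 : (2 * |x|) ^ 3 ≤ |q| ^ 3 := by gcongr
  calc _ ≤ |x| ^ 3 * 8 := by gcongr
    _ = (2 * |x|) ^ 3 := by ring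
    _ ≤ _ := h5

theorem isBigO_cube_of_abs_le {f : ℝ → ℝ} {C : ℝ} (h : ∀ q, |q| ≤ 1 → |f q| ≤ C * |q| ^ 3) :
    f =O[𝓝 0] fun q : ℝ => q ^ 3 := by
  refine IsBigO.of_bound C ?_
  filter_upwards [Metric.closedBall_mem_nhds (0 : ℝ) one_pos] with q hq
  have : |q| ≤ 1 := by simpa using hq
  simpa using h q this

theorem isBigO_stdEnergy (q : ℝ) :
    (fun x : ℝ => stdEnergy x q - (-1 + q ^ 2 / 3 - 2 * q * x + 2 * x ^ 2))
      =O[𝓝 0] (fun x : ℝ => x ^ 4) := by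
  refine IsBigO.of_bound 4 ?_
  filter_upwards [Metric.closedBall_mem_nhds (0 : ℝ) (by norm_num : (0 : ℝ) < 1 / 2)] with x hx
  have : |x| ≤ 1 / 2 := by simpa using hx
  rw [Real.norm_eq_abs, Real.norm_of_nonneg (by positivity : 0 ≤ x ^ 4)]
  exact abs_stdEnergy_sub_le q this

theorem abs_stdEnergy_sub_expansion_le {x q : ℝ} (hq : |q| ≤ 1) (h1 : 2 * |x| ≤ |q|)
    (h2 : |x - q / 2| ≤ |q| ^ 3) : |stdEnergy x q - (-1 - q ^ 2 / 6)| ≤ 3 * |q| ^ 3 := by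
  have h3 := abs_stdEnergy_sub_le q (x := x) (by linarith)
  have h0 := abs_nonneg q
  have hx4 : 4 * x ^ 4 ≤ |q| ^ 3 := by
    have h4 : (2 * |x|) ^ 4 ≤ |q| ^ 4 := by gcongr
    have h5 : |q| ^ 4 ≤ |q| ^ 3 := pow_le_pow_of_le_one h0 hq (by norm_num)
    rw [mul_pow, Even.pow_abs (by decide)] at h4
    nlinarith [pow_nonneg h0 3, sq_nonneg (x ^ 2)]
  have hd : (x - q / 2) ^ 2 ≤ |q| ^ 3 := by
    rw [← sq_abs]
    have h5 : (|q| ^ 3) ^ 2 ≤ |q| ^ 3 * 1 := by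
      rw [sq]; gcongr; exact pow_le_one₀ h0 hq
    calc |x - q / 2| ^ 2 ≤ (|q| ^ 3) ^ 2 := by gcongr
      _ ≤ _ := by linarith
  -- Completing the square: near `x = q/2` the error in the position enters only quadratically.
  have h6 : stdEnergy x q - (-1 - q ^ 2 / 6)
      = (stdEnergy x q - (-1 + q ^ 2 / 3 - 2 * q * x + 2 * x ^ 2)) + 2 * (x - q / 2) ^ 2 := by ring
  rw [h6]
  refine (abs_add_le _ _).trans ?_
  rw [abs_of_nonneg (a := 2 * (x - q / 2) ^ 2) (by positivity)]
  linarith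

/-- The envelope principle: along the equilibrium curve, parametrized by `x` to avoid
differentiating the inverse function, the partial derivative in `x` vanishes. What remains is `∂_q =
2(q/3 - x)` times the derivative of `equilibriumCharge`. -/
theorem hasDerivAt_stdEnergy_equilibriumCharge {x : ℝ} (hx : x ∈ Ioo (-1 : ℝ) 1) :
    HasDerivAt (fun y => stdEnergy y (equilibriumCharge y))
      (2 * (equilibriumCharge x / 3 - x) * ((2 + 3 * x ^ 2 - x ^ 4) / (1 - x ^ 2) ^ 3)) x := by
  have hg := hasDerivAt_equilibriumCharge hx
  have h1 := hasDerivAt_stdEnergy 0 hx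
  have h2 := (h1.sub ((hg.const_mul 2).mul (hasDerivAt_id x))).add ((hg.pow 2).div_const 3)
  have h3 : (fun y => stdEnergy y (equilibriumCharge y)) = fun y => stdEnergy y 0
      - 2 * equilibriumCharge y * y + equilibriumCharge y ^ 2 / 3 := by
    funext y
    simp only [stdEnergy]
    ring
  rw [h3]
  refine h2.congr_deriv ?_
  simp only [id]
  ring

/-- With `s = x²` the claim is `3s² - 5s + 1 > 0`, which holds for `s < 4/25`. -/
theorem equilibriumCharge_div_lt {x : ℝ} (h0 : 0 < x) (hx : x < 2 / 5) :
    equilibriumCharge x / 3 < x := by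
  have h1 : 0 < 1 - x ^ 2 := one_sub_sq_pos_of_mem_Ioo ⟨by linarith, by linarith⟩
  rw [equilibriumCharge, div_lt_iff₀ three_pos, div_lt_iff₀ (by positivity), mul_assoc]
  refine mul_lt_mul_of_pos_left ?_ h0
  nlinarith [sq_nonneg (x ^ 2)]

theorem strictAntiOn_stdEnergy_equilibriumPosition :
    StrictAntiOn (fun q => stdEnergy (equilibriumPosition q) q) (Icc 0 (4 / 5)) := by
  have hsub : Icc (0 : ℝ) (2 / 5) ⊆ Ioo (-1) 1 := fun x hx =>
    ⟨by linarith [hx.1], by linarith [hx.2]⟩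
  have h : StrictAntiOn (fun y => stdEnergy y (equilibriumCharge y)) (Icc 0 (2 / 5)) := by
    refine strictAntiOn_of_deriv_neg (convex_Icc _ _) (fun x hx =>
      (hasDerivAt_stdEnergy_equilibriumCharge (hsub hx)).continuousAt.continuousWithinAt)
      fun x hx => ?_
    rw [interior_Icc] at hx
    have hx' := hsub (Ioo_subset_Icc_self hx)
    rw [(hasDerivAt_stdEnergy_equilibriumCharge hx').deriv]
    exact mul_neg_of_neg_of_pos (by linarith [equilibriumCharge_div_lt hx.1 hx.2])
      (deriv_equilibriumCharge_pos hx')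
  -- The range `4/5` of charges is twice the range `2/5` of positions, by `2|x| ≤ |q|`.
  have hmaps : ∀ q ∈ Icc (0 : ℝ) (4 / 5), equilibriumPosition q ∈ Icc (0 : ℝ) (2 / 5) := by
    intro q hq
    refine ⟨equilibriumPosition_zero ▸ strictMono_equilibriumPosition.monotone hq.1, ?_⟩
    have := two_mul_abs_equilibriumPosition_le q
    rw [abs_of_nonneg hq.1] at this
    linarith [le_abs_self (equilibriumPosition q), hq.2]
  intro q₁ h₁ q₂ h₂ hlt
  have := h (hmaps q₁ h₁) (hmaps q₂ h₂) (strictMono_equilibriumPosition hlt)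
  simpa only [equilibriumCharge_equilibriumPosition] using this

theorem equilibriumPosition_neg (q : ℝ) : equilibriumPosition (-q) = -equilibriumPosition q := by
  have hX := equilibriumPosition_mem q
  refine ((eq_equilibriumPosition_iff ⟨by linarith [hX.2], by linarith [hX.1]⟩).1 ?_).symm
  rw [equilibriumCharge_neg, equilibriumCharge_equilibriumPosition]

theorem stdEnergy_neg_neg (x q : ℝ) : stdEnergy (-x) (-q) = stdEnergy x q := by
  simp only [stdEnergy, neg_sq]
  ring

theorem strictMonoOn_stdEnergy_equilibriumPosition :
    StrictMonoOn (fun q => stdEnergy (equilibriumPosition q) q) (Icc (-(4 / 5)) 0) := by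
  intro q₁ h₁ q₂ h₂ hlt
  have := strictAntiOn_stdEnergy_equilibriumPosition (a := -q₂) (b := -q₁)
    ⟨by linarith [h₂.2], by linarith [h₂.1]⟩ ⟨by linarith [h₁.2], by linarith [h₁.1]⟩ (by linarith)
  simpa only [equilibriumPosition_neg, stdEnergy_neg_neg] using this

/-! ### Minimization over all positions in the ball. -/

section

variable {R e : ℝ}

theorem IsNeumannSolution.renormalizedEnergy_eq_std (m : ℝ) (hR : 0 < R) (he : e ≠ 0)
    {a u : Space3} (hu : ‖u‖ = 1) (ha : a ∈ ball (0 : Space3) R) {E : ℝ} {φ : Space3 → ℝ}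
    {D : Space3 → Space3} (h : IsNeumannSolution R e a (E • u) φ D) :
    renormalizedEnergy m R e a D = m + e ^ 2 / (8 * Real.pi * R)
      * (1 / (1 - (‖a‖ / R) ^ 2) - Real.log (1 - (‖a‖ / R) ^ 2)
        - 2 * (4 * Real.pi * R ^ 2 / e * E) * (inner ℝ a u / R)
        + (4 * Real.pi * R ^ 2 / e * E) ^ 2 / 3 - 2) := by
  have haR : ‖a‖ < R := by simpa using ha
  have h1 : R ^ 2 - ‖a‖ ^ 2 ≠ 0 := by nlinarith [norm_nonneg a]
  have h2 : 1 / (1 - (‖a‖ / R) ^ 2) = R ^ 2 / (R ^ 2 - ‖a‖ ^ 2) := by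
    have : 1 - (‖a‖ / R) ^ 2 = (R ^ 2 - ‖a‖ ^ 2) / R ^ 2 := by field_simp
    rw [this, one_div_div]
  have hpi := Real.pi_pos
  rw [h.renormalizedEnergy_eq m hR ha, h2, norm_smul, hu, mul_one, Real.norm_eq_abs, sq_abs,
    real_inner_smul_right, div_pow]
  field_simp
  ring

theorem abs_inner_div_lt_one (hR : 0 < R) {a u : Space3} (hu : ‖u‖ = 1)
    (ha : a ∈ ball (0 : Space3) R) : inner ℝ a u / R ∈ Ioo (-1 : ℝ) 1 := by
  have haR : ‖a‖ < R := by simpa using ha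
  have h := abs_real_inner_le_norm a u
  rw [hu, mul_one] at h
  rw [mem_Ioo, ← abs_lt, abs_div, abs_of_pos hR, div_lt_one hR]
  linarith

theorem eq_inner_smul_of_sq_eq {a u : Space3} (hu : ‖u‖ = 1) (h : inner ℝ a u ^ 2 = ‖a‖ ^ 2) :
    a = (inner ℝ a u : ℝ) • u := by
  have : ‖a - (inner ℝ a u : ℝ) • u‖ ^ 2 = 0 := by
    rw [norm_sub_sq_real, norm_smul, hu, mul_one, real_inner_smul_right, Real.norm_eq_abs, sq_abs]
    linarith
  rwa [sq_eq_zero_iff, norm_eq_zero, sub_eq_zero] at this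

/-- Projecting `a` onto the axis keeps the linear term and strictly lowers `1/(1-ρ²) - log(1-ρ²)`,
with `ρ = ‖a‖/R`, unless `a` is already on the axis; there the one-variable result applies. -/
theorem stdEnergy_equilibriumPosition_lt_of_ne (hR : 0 < R) {a u : Space3} (hu : ‖u‖ = 1)
    (ha : a ∈ ball (0 : Space3) R) {q : ℝ} (hne : a ≠ (R * equilibriumPosition q) • u) :
    stdEnergy (equilibriumPosition q) q < 1 / (1 - (‖a‖ / R) ^ 2)
      - Real.log (1 - (‖a‖ / R) ^ 2) - 2 * q * (inner ℝ a u / R) + q ^ 2 / 3 - 2 := by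
  have haR : ‖a‖ < R := by simpa using ha
  have ht := abs_inner_div_lt_one hR hu ha
  have hy : (‖a‖ / R) ^ 2 < 1 := by
    have : ‖a‖ / R < 1 := (div_lt_one hR).2 haR
    have : 0 ≤ ‖a‖ / R := by positivity
    nlinarith
  have hle : (inner ℝ a u / R) ^ 2 ≤ (‖a‖ / R) ^ 2 := by
    have h := abs_real_inner_le_norm a u
    rw [hu, mul_one] at h
    rw [div_pow, div_pow, ← sq_abs (inner ℝ a u)]
    gcongr
  rcases hle.lt_or_eq with hlt | heq
  · have h1 : stdEnergy (equilibriumPosition q) q ≤ stdEnergy (inner ℝ a u / R) q := by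
      by_cases h : inner ℝ a u / R = equilibriumPosition q
      · rw [h]
      · exact (stdEnergy_equilibriumPosition_lt ht h).le
    refine h1.trans_lt ?_
    have h2 : 1 / (1 - (inner ℝ a u / R) ^ 2) < 1 / (1 - (‖a‖ / R) ^ 2) :=
      one_div_lt_one_div_of_lt (by linarith) (by linarith)
    have h3 : Real.log (1 - (‖a‖ / R) ^ 2) < Real.log (1 - (inner ℝ a u / R) ^ 2) :=
      Real.log_lt_log (by linarith) (by linarith)
    rw [stdEnergy]
    linarith
  · rw [← heq]
    refine stdEnergy_equilibriumPosition_lt ht fun h => hne ?_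
    rw [div_pow, div_pow, div_left_inj' (by positivity)] at heq
    rw [← h, mul_div_cancel₀ _ hR.ne']
    exact eq_inner_smul_of_sq_eq hu heq

theorem smul_mem_ball (hR : 0 < R) {u : Space3} (hu : ‖u‖ = 1) {x : ℝ} (hx : x ∈ Ioo (-1 : ℝ) 1) :
    (R * x) • u ∈ ball (0 : Space3) R := by
  rw [mem_ball_zero_iff, norm_smul, hu, mul_one, Real.norm_eq_abs, abs_mul, abs_of_pos hR]
  have : |x| < 1 := abs_lt.2 hx
  nlinarith

theorem IsNeumannSolution.renormalizedEnergy_smul_eq (m : ℝ) (hR : 0 < R) (he : e ≠ 0)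
    {u : Space3} (hu : ‖u‖ = 1) {x : ℝ} (hx : x ∈ Ioo (-1 : ℝ) 1) {E : ℝ} {φ : Space3 → ℝ}
    {D : Space3 → Space3} (h : IsNeumannSolution R e ((R * x) • u) (E • u) φ D) :
    renormalizedEnergy m R e ((R * x) • u) D
      = m + e ^ 2 / (8 * Real.pi * R) * stdEnergy x (4 * Real.pi * R ^ 2 / e * E) := by
  have h1 : (‖(R * x) • u‖ / R) ^ 2 = x ^ 2 := by
    rw [norm_smul, hu, mul_one, Real.norm_eq_abs, div_pow, sq_abs]
    field_simp
  have h2 : inner ℝ ((R * x) • u) u / R = x := by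
    rw [real_inner_smul_left, real_inner_self_eq_norm_sq, hu]
    field_simp
  rw [h.renormalizedEnergy_eq_std m hR he hu (smul_mem_ball hR hu hx), h1, h2, stdEnergy]

theorem isEnergyMinimizing_iff (m : ℝ) (hR : 0 < R) (he : e ≠ 0) {u : Space3} (hu : ‖u‖ = 1)
    (E : ℝ) (a : Space3) : IsEnergyMinimizing m R e (E • u) a ↔
      a = (R * equilibriumPosition (4 * Real.pi * R ^ 2 / e * E)) • u := by
  have hpi := Real.pi_pos
  have hc : 0 < e ^ 2 / (8 * Real.pi * R) := by positivity
  set q := 4 * Real.pi * R ^ 2 / e * E with hq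
  have hX := equilibriumPosition_mem q
  have hlt : ∀ b ∈ ball (0 : Space3) R, b ≠ (R * equilibriumPosition q) • u →
      ∀ φ D φ' D', IsNeumannSolution R e ((R * equilibriumPosition q) • u) (E • u) φ D →
        IsNeumannSolution R e b (E • u) φ' D' →
        renormalizedEnergy m R e ((R * equilibriumPosition q) • u) D
          < renormalizedEnergy m R e b D' := by
    intro b hb hne φ D φ' D' h h'
    rw [h.renormalizedEnergy_smul_eq m hR he hu hX, h'.renormalizedEnergy_eq_std m hR he hu hb]
    gcongr
    exact stdEnergy_equilibriumPosition_lt_of_ne hR hu hb hne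
  constructor
  · rintro ⟨ha, hmin⟩
    by_contra hne
    have hb := smul_mem_ball hR hu hX
    -- Minimality quantifies over all solutions and would be empty without one; the explicit
    -- solutions at both positions give the contradiction.
    have h := isNeumannSolution_regField (e := e) hR ha (E • u)
    have h' := isNeumannSolution_regField (e := e) hR hb (E • u)
    exact absurd (hmin _ _ h _ hb _ _ h') (not_le.2 (hlt a ha hne _ _ _ _ h' h))
  · rintro rfl
    refine ⟨smul_mem_ball hR hu hX, fun φ D h b hb φ' D' h' => ?_⟩
    by_cases hne : b = (R * equilibriumPosition q) • u
    · subst hne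
      rw [h.renormalizedEnergy_smul_eq m hR he hu hX, h'.renormalizedEnergy_smul_eq m hR he hu hX]
    · exact (hlt b hb hne φ D φ' D' h h').le

theorem exists_unit_smul_norm_eq (E : Space3) : ∃ u : Space3, ‖u‖ = 1 ∧ E = ‖E‖ • u := by
  by_cases hE : E = 0
  · exact ⟨EuclideanSpace.single 0 1, by simp, by simp [hE]⟩
  · have : ‖E‖ ≠ 0 := norm_ne_zero_iff.2 hE
    exact ⟨‖E‖⁻¹ • E, by simp [norm_smul, this], by simp [smul_smul, this]⟩

theorem IsEnergyMinimizing.renormalizedEnergy_eq {m : ℝ} (hR : 0 < R) (he : e ≠ 0) {E a : Space3}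
    (ha : IsEnergyMinimizing m R e E a) {φ : Space3 → ℝ} {D : Space3 → Space3}
    (h : IsNeumannSolution R e a E φ D) :
    renormalizedEnergy m R e a D = m + e ^ 2 / (8 * Real.pi * R)
      * stdEnergy (equilibriumPosition (4 * Real.pi * R ^ 2 / e * ‖E‖))
        (4 * Real.pi * R ^ 2 / e * ‖E‖) := by
  obtain ⟨u, hu, hE⟩ := exists_unit_smul_norm_eq E
  rw [hE] at ha h
  rw [isEnergyMinimizing_iff m hR he hu] at ha
  subst ha
  exact h.renormalizedEnergy_smul_eq m hR he hu (equilibriumPosition_mem _)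

theorem IsNeumannSolution.self_eq_zero_iff (hR : 0 < R) (he : e ≠ 0) {u : Space3} (hu : ‖u‖ = 1)
    {x : ℝ} (hx : x ∈ Ioo (-1 : ℝ) 1) {E : ℝ} {φ : Space3 → ℝ} {D : Space3 → Space3}
    (h : IsNeumannSolution R e ((R * x) • u) (E • u) φ D) :
    D ((R * x) • u) = 0 ↔ 4 * Real.pi * R ^ 2 / e * E = x * (2 - x ^ 2) / (1 - x ^ 2) ^ 2 := by
  have ha := smul_mem_ball hR hu hx
  have h1 := one_sub_sq_pos_of_mem_Ioo hx
  have hu0 : u ≠ 0 := norm_ne_zero_iff.1 (by rw [hu]; exact one_ne_zero)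
  have hn : ‖(R * x) • u‖ ^ 2 = R ^ 2 * x ^ 2 := by
    rw [norm_smul, hu, mul_one, Real.norm_eq_abs, sq_abs, mul_pow]
  have hpi := Real.pi_pos
  have h2 : R ^ 2 - R ^ 2 * x ^ 2 = R ^ 2 * (1 - x ^ 2) := by ring
  have hD : D ((R * x) • u) = regField R e ((R * x) • u) ((R * x) • u) + E • u :=
    h.eqOn hR (isNeumannSolution_regField hR ha (E • u)) (ball_subset_closedBall ha)
  rw [hD, regField_self hR ha, hn, smul_smul, ← neg_smul, ← add_smul, smul_eq_zero_iff_left hu0, h2,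
    neg_add_eq_zero, eq_comm]
  field_simp

end

/-! ### Assembly of the main theorem. -/

theorem mainTheorem1 (m R e : ℝ) (hR : 0 < R) (he : e ≠ 0) :
    -- the field problem is solvable for all positions and all boundary fields
    (∀ a ∈ ball (0 : Space3) R, ∀ E : Space3,
      ∃ (φ : Space3 → ℝ) (D : Space3 → Space3), IsNeumannSolution R e a E φ D) ∧
    -- energy and equilibrium for positions parallel to the boundary field
    (∀ u : Space3, ‖u‖ = 1 → ∀ E r₀ : ℝ, |r₀| < R →
      ∀ (φ : Space3 → ℝ) (D : Space3 → Space3),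
        IsNeumannSolution R e (r₀ • u) (E • u) φ D →
        ∀ x q : ℝ, x = r₀ / R → q = 4 * Real.pi * R ^ 2 / e * E →
          EnergyConverges R e (r₀ • u) D ∧
          renormalizedEnergy m R e (r₀ • u) D
            = m + 1 / 2 * (e ^ 2 / (4 * Real.pi)
                  * (R / (R ^ 2 - r₀ ^ 2) - 1 / R * Real.log (1 - r₀ ^ 2 / R ^ 2) - 2 / R)
                + 4 / 3 * Real.pi * R ^ 3 * E ^ 2 - 2 * e * E * r₀) ∧
          (renormalizedEnergy m R e (r₀ • u) D - m) * (8 * Real.pi * R / e ^ 2)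
            = stdEnergy x q ∧
          (D (r₀ • u) = 0 ↔ q = x * (2 - x ^ 2) / (1 - x ^ 2) ^ 2)) ∧
    -- stationary points of the standardized energy
    (∀ q : ℝ, ∀ x ∈ Ioo (-1 : ℝ) 1,
      DifferentiableAt ℝ (fun y => stdEnergy y q) x ∧
      (deriv (fun y => stdEnergy y q) x = 0 ↔ q = x * (2 - x ^ 2) / (1 - x ^ 2) ^ 2)) ∧
    -- expansion of the standardized energy for small displacements
    (∀ q : ℝ, (fun x : ℝ => stdEnergy x q - (-1 + q ^ 2 / 3 - 2 * q * x + 2 * x ^ 2))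
      =O[𝓝 0] (fun x : ℝ => x ^ 4)) ∧
    -- the minimizing position `X q` and the energy there
    (∃ X : ℝ → ℝ,
      (∀ q : ℝ, X q ∈ Ioo (-1 : ℝ) 1 ∧
        (∀ x ∈ Ioo (-1 : ℝ) 1, x ≠ X q → stdEnergy (X q) q < stdEnergy x q) ∧
        (∀ x ∈ Ioo (-1 : ℝ) 1, q = x * (2 - x ^ 2) / (1 - x ^ 2) ^ 2 ↔ x = X q)) ∧
      (∀ u : Space3, ‖u‖ = 1 → ∀ E : ℝ, ∀ a : Space3,
        IsEnergyMinimizing m R e (E • u) a ↔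
          a = (R * X (4 * Real.pi * R ^ 2 / e * E)) • u) ∧
      (fun q : ℝ => X q - q / 2) =O[𝓝 0] (fun q : ℝ => q ^ 3) ∧
      (fun q : ℝ => stdEnergy (q / 2) q - (-1 - q ^ 2 / 6)) =O[𝓝 0] (fun q : ℝ => q ^ 3) ∧
      (fun q : ℝ => stdEnergy (X q) q - (-1 - q ^ 2 / 6)) =O[𝓝 0] (fun q : ℝ => q ^ 3) ∧
      (∃ δ > 0, StrictAntiOn (fun q : ℝ => stdEnergy (X q) q) (Icc 0 δ) ∧
        StrictMonoOn (fun q : ℝ => stdEnergy (X q) q) (Icc (-δ) 0))) ∧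
    -- static instability: the total energy decreases when a small boundary field grows
    (∃ δ > 0, ∀ E₁ E₂ : Space3, ‖E₁‖ < ‖E₂‖ → ‖E₂‖ ≤ δ →
      ∀ a₁ a₂ : Space3, IsEnergyMinimizing m R e E₁ a₁ → IsEnergyMinimizing m R e E₂ a₂ →
      ∀ (φ₁ φ₂ : Space3 → ℝ) (D₁ D₂ : Space3 → Space3),
        IsNeumannSolution R e a₁ E₁ φ₁ D₁ → IsNeumannSolution R e a₂ E₂ φ₂ D₂ →
        renormalizedEnergy m R e a₂ D₂ < renormalizedEnergy m R e a₁ D₁) := by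
  have hpi := Real.pi_pos
  have hgdef : ∀ x : ℝ, x * (2 - x ^ 2) / (1 - x ^ 2) ^ 2 = equilibriumCharge x := fun _ => rfl
  refine ⟨fun a ha E => ⟨_, _, isNeumannSolution_regField hR ha E⟩, ?_, ?_, isBigO_stdEnergy,
    ⟨equilibriumPosition, ?_, fun u hu E a => isEnergyMinimizing_iff m hR he hu E a, ?_, ?_, ?_,
      4 / 5, by norm_num, strictAntiOn_stdEnergy_equilibriumPosition,
      strictMonoOn_stdEnergy_equilibriumPosition⟩, ?_⟩
  · intro u hu E r₀ hr₀ φ D h x q hx hq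
    have hxI : x ∈ Ioo (-1 : ℝ) 1 := by
      rw [mem_Ioo, ← abs_lt, hx, abs_div, abs_of_pos hR, div_lt_one hR]
      exact hr₀
    obtain rfl : r₀ = R * x := by rw [hx]; field_simp
    have ha := smul_mem_ball hR hu hxI
    refine ⟨energyConverges_of_continuousOn ha h.continuousOn, ?_, ?_, ?_⟩
    · rw [h.renormalizedEnergy_eq m hR ha, norm_smul, norm_smul, hu, real_inner_smul_left,
        real_inner_smul_right, real_inner_self_eq_norm_sq, hu, Real.norm_eq_abs, Real.norm_eq_abs,
        mul_one, mul_one, sq_abs, sq_abs]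
      ring
    · rw [h.renormalizedEnergy_smul_eq m hR he hu hxI, hq]
      field_simp
      ring
    · rw [hq]
      exact h.self_eq_zero_iff hR he hu hxI
  · intro q x hx
    have h := hasDerivAt_stdEnergy q hx
    refine ⟨h.differentiableAt, ?_⟩
    rw [h.deriv, hgdef, mul_eq_zero_iff_left two_ne_zero, sub_eq_zero, eq_comm]
  · exact fun q => ⟨equilibriumPosition_mem q, fun x hx hne => stdEnergy_equilibriumPosition_lt hx hne,
      fun x hx => eq_equilibriumPosition_iff hx⟩
  · exact isBigO_cube_of_abs_le (C := 1) fun q hq => by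
      simpa using abs_equilibriumPosition_sub_le hq
  · refine isBigO_cube_of_abs_le (C := 3) fun q hq => abs_stdEnergy_sub_expansion_le hq ?_ ?_
    · rw [abs_div, abs_two]; linarith
    · simp
  · exact isBigO_cube_of_abs_le (C := 3) fun q hq => abs_stdEnergy_sub_expansion_le hq
      (two_mul_abs_equilibriumPosition_le q) (abs_equilibriumPosition_sub_le hq)
  -- This is the field strength at which `|q| = 4/5`. The sign of `q` is that of `e`, which decides
  -- which of the two monotonicity intervals applies.
  · refine ⟨4 / 5 * |e| / (4 * Real.pi * R ^ 2), by positivity, ?_⟩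
    intro E₁ E₂ hlt hle a₁ a₂ ha₁ ha₂ φ₁ φ₂ D₁ D₂ h₁ h₂
    rw [ha₁.renormalizedEnergy_eq hR he h₁, ha₂.renormalizedEnergy_eq hR he h₂]
    have hc : 0 < e ^ 2 / (8 * Real.pi * R) := by positivity
    refine add_lt_add_right (mul_lt_mul_of_pos_left ?_ hc) m
    rw [le_div_iff₀ (by positivity)] at hle
    have hn₁ := norm_nonneg E₁
    have hk : 0 < 4 * Real.pi * R ^ 2 := by positivity
    rcases lt_or_gt_of_ne he with hneg | hpos
    · have hc' : 4 * Real.pi * R ^ 2 / e < 0 := div_neg_of_pos_of_neg hk hneg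
      rw [abs_of_neg hneg] at hle
      have h5 : -(4 / 5) ≤ 4 * Real.pi * R ^ 2 / e * ‖E₂‖ := by
        rw [div_mul_eq_mul_div, le_div_iff_of_neg hneg]; linarith
      have h6 : 4 * Real.pi * R ^ 2 / e * ‖E₂‖ < 4 * Real.pi * R ^ 2 / e * ‖E₁‖ :=
        mul_lt_mul_of_neg_left hlt hc'
      have h7 : 4 * Real.pi * R ^ 2 / e * ‖E₁‖ ≤ 0 := mul_nonpos_of_nonpos_of_nonneg hc'.le hn₁
      exact strictMonoOn_stdEnergy_equilibriumPosition ⟨h5, h6.le.trans h7⟩ ⟨h5.trans h6.le, h7⟩ h6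
    · have hc' : 0 < 4 * Real.pi * R ^ 2 / e := div_pos hk hpos
      rw [abs_of_pos hpos] at hle
      have h5 : 4 * Real.pi * R ^ 2 / e * ‖E₂‖ ≤ 4 / 5 := by
        rw [div_mul_eq_mul_div, div_le_iff₀ hpos]; linarith
      have h6 : 4 * Real.pi * R ^ 2 / e * ‖E₁‖ < 4 * Real.pi * R ^ 2 / e * ‖E₂‖ :=
        mul_lt_mul_of_pos_left hlt hc'
      have h7 : 0 ≤ 4 * Real.pi * R ^ 2 / e * ‖E₁‖ := by positivity
      exact strictAntiOn_stdEnergy_equilibriumPosition ⟨h7, h6.le.trans h5⟩ ⟨h7.trans h6.le, h5⟩ h6
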